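/- Let $\alpha$ be an infinite ordinal. Consider algebras (with nonempty carrier) of the similarity type $\{\cdot,-,s^i_j,s_{ij}\}_{i\neq j\in\alpha}$, where $\cdot$ is binary and $-$, $s^i_j$, $s_{ij}$ are unary; $x+y$ abbreviates $-(-x\cdot-y)$, $0$ stands for $x\cdot -x$, $1$ for $x+-x$, and $x\le y$ means $x\cdot y=x$. Let $\Sigma_\alpha$ be the following set of equations, where $i,j,k,l$ range over all distinct elements of $\alpha$: 1. the axioms of Boolean algebras; 2. each $s_{ij}$ and each $s^i_j$ preserves $\cdot$, $+$, $0$ and $1$ (that is, it is a Boolean endomorphism); 3. $s_{ij}x=s_{ji}x$, $\;s_{ij}s_{ij}x=x$, $\;s_{ij}s_{jk}s_{ij}x=s_{ik}x$, $\;s_{ij}s_{kl}x=s_{kl}s_{ij}x$; 4. $s_{kl}s^j_is_{kl}x=s^j_ix$, $\;s_{jk}s^j_is_{jk}x=s^k_ix$, $\;s_{ki}s^j_is_{ki}x=s^j_kx$, $\;s_{ij}s^j_is_{ij}x=s^i_jx$; 5. $s^j_is^k_lx=s^k_ls^j_ix$, $\;s^j_is^k_ix=s^k_is^j_ix=s^j_is^k_jx$,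 $\;s^j_is^i_kx=s^j_ks_{ij}x$, $\;s^j_is^j_kx=s^j_kx$, $\;s^j_is^j_ix=s^j_ix$, $\;s^j_is^i_jx=s^j_ix$, $\;s^j_is_{ij}x=s^j_ix$. Let $SA_\alpha=\mathbf{Mod}(\Sigma_\alpha)$ be the class of all algebras of this type that satisfy $\Sigma_\alpha$. For $i,j\in\alpha$ let $[i|j]:\alpha\to\alpha$ be the map that takes $i$ to $j$ and fixes all other elements, and let $[i,j]$ be the transposition of $i$ and $j$. Let ${}^\alpha\alpha^{(Id)}=\{s\in{}^\alpha\alpha:\{i:s_i\neq i\}\text{ is finite}\}$. A set $V\subseteq{}^\alpha\alpha^{(Id)}$ is locally square if $s\circ[i|j]\in V$ and $s\circ[i,j]\in V$ whenever $s\in V$ and $i,j\in\alpha$. For such a $V$ let $\wp(V)=\langle\mathcal P(V),\cap,\sim,S^i_j,S_{ij}\rangle_{i\ne j\in\alpha}$, where $\sim$ is complement relative to $V$, $S^i_jX=\{q\in V:q\circ[i|j]\in X\}$ and $S_{ij}X=\{q\in V:q\circ[i,j]\in X\}$. Let $WSA_\alpha$ be the variety generated by all algebras $\wp(V)$ with $V\subseteq{}^\alpha\alpha^{(Id)}$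 locally square, that is, the smallest class of algebras that contains them and is closed under homomorphic images, (isomorphic copies of) subalgebras and direct products. Then: (1) $SA_\alpha=WSA_\alpha$. (2) $SA_\alpha$ has the superamalgamation property: for all $A,B,C\in SA_\alpha$ and all injective homomorphisms $f:A\to B$, $g:A\to C$ there are $D\in SA_\alpha$ and injective homomorphisms $m:B\to D$, $n:C\to D$ with $m\circ f=n\circ g$ such that for all $b\in B$ and $c\in C$: if $m(b)\le n(c)$, then there is $a\in A$ with $b\le f(a)$ and $g(a)\le c$; and if $n(c)\le m(b)$, then there is $a\in A$ with $c\le g(a)$ and $f(a)\le b$. -/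

import Mathlib

open FirstOrder

universe u

namespace SubstAlg

/-- Operation symbols of the similarity type `{·, -, sⁱⱼ, s_ij}`, for distinct `i, j ∈ I`. -/
inductive Op (I : Type u) : ℕ → Type u
  | meet : Op I 2
  | compl : Op I 1
  /-- `repl i j` is the symbol `sⁱⱼ`, with upper index `i` and lower index `j`. -/
  | repl (i j : I) (h : i ≠ j) : Op I 1
  /-- `transp i j` is the symbol `s_ij`. -/
  | transp (i j : I) (h : i ≠ j) : Op I 1

/-- The algebraic language with operation symbols `·, -, sⁱⱼ, s_ij`. -/
def lang (I : Type u) : FirstOrder.Language.{u, 0} := ⟨Op I, fun _ => Empty⟩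

/-- An algebra of this similarity type, with nonempty carrier. -/
structure Alg (I : Type u) where
  carrier : Type u
  [nonempty : Nonempty carrier]
  [str : (lang I).Structure carrier]

attribute [instance] Alg.nonempty Alg.str

instance (I : Type u) : CoeSort (Alg.{u} I) (Type u) := ⟨Alg.carrier⟩

/-! ### Terms, equations and the axioms -/

/-- Terms in the variables `v₀, v₁, …`. -/
abbrev Tm (I : Type u) := (lang I).Term ℕ

section Terms

variable {I : Type u}

/-- `s · t` -/
def Tm.meet (s t : Tm I) : Tm I := FirstOrder.Language.Term.func (L := lang I) (l := 2) Op.meet ![s, t]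

/-- `- t` -/
def Tm.neg (t : Tm I) : Tm I := FirstOrder.Language.Term.func (L := lang I) (l := 1) Op.compl ![t]

/-- `s + t`, an abbreviation of `-(-s · -t)` -/
def Tm.join (s t : Tm I) : Tm I := ((s.neg).meet t.neg).neg

/-- `sⁱⱼ t` -/
def Tm.repl (i j : I) (h : i ≠ j) (t : Tm I) : Tm I :=
  FirstOrder.Language.Term.func (L := lang I) (l := 1) (Op.repl i j h) ![t]

/-- `s_ij t` -/
def Tm.transp (i j : I) (h : i ≠ j) (t : Tm I) : Tm I :=
  FirstOrder.Language.Term.func (L := lang I) (l := 1) (Op.transp i j h) ![t]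

/-- The variable `v₀`. -/
def Tm.x : Tm I := FirstOrder.Language.Term.var 0
/-- The variable `v₁`. -/
def Tm.y : Tm I := FirstOrder.Language.Term.var 1
/-- The variable `v₂`. -/
def Tm.z : Tm I := FirstOrder.Language.Term.var 2

/-- `0`, as the term `x · -x` -/
def Tm.zero : Tm I := Tm.x.meet Tm.x.neg

/-- `1`, as the term `x + -x` -/
def Tm.one : Tm I := Tm.x.join Tm.x.neg

end Terms

open Tm in
/-- `Ax I s t` says that the equation `s = t` belongs to the axiom system `Σ_I`, which is given by
finitely many schemas, whose indices range over all tuples of distinct members of `I`. -/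
inductive Ax (I : Type u) : Tm I → Tm I → Prop
  -- the Boolean axioms
  | meet_comm : Ax I (x.meet y) (y.meet x)
  | meet_assoc : Ax I (x.meet (y.meet z)) ((x.meet y).meet z)
  | join_comm : Ax I (x.join y) (y.join x)
  | join_assoc : Ax I (x.join (y.join z)) ((x.join y).join z)
  | meet_join_absorb : Ax I (x.meet (x.join y)) x
  | join_meet_absorb : Ax I (x.join (x.meet y)) x
  | meet_join_distrib : Ax I (x.meet (y.join z)) ((x.meet y).join (x.meet z))
  | join_meet_distrib : Ax I (x.join (y.meet z)) ((x.join y).meet (x.join z))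
  | join_zero : Ax I (y.join zero) y
  | meet_one : Ax I (y.meet one) y
  -- the substitution operations are Boolean endomorphisms
  | transp_meet (i j : I) (h : i ≠ j) :
      Ax I ((x.meet y).transp i j h) ((x.transp i j h).meet (y.transp i j h))
  | transp_join (i j : I) (h : i ≠ j) :
      Ax I ((x.join y).transp i j h) ((x.transp i j h).join (y.transp i j h))
  | transp_zero (i j : I) (h : i ≠ j) : Ax I (zero.transp i j h) zero
  | transp_one (i j : I) (h : i ≠ j) : Ax I (one.transp i j h) one
  | repl_meet (i j : I) (h : i ≠ j) :
      Ax I ((x.meet y).repl i j h) ((x.repl i j h).meet (y.repl i j h))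
  | repl_join (i j : I) (h : i ≠ j) :
      Ax I ((x.join y).repl i j h) ((x.repl i j h).join (y.repl i j h))
  | repl_zero (i j : I) (h : i ≠ j) : Ax I (zero.repl i j h) zero
  | repl_one (i j : I) (h : i ≠ j) : Ax I (one.repl i j h) one
  -- the relations between transpositions
  /-- `s_ij x = s_ji x` -/
  | transp_symm (i j : I) (hij : i ≠ j) : Ax I (transp i j hij x) (transp j i hij.symm x)
  /-- `s_ij s_ij x = x` -/
  | transp_transp (i j : I) (hij : i ≠ j) : Ax I (transp i j hij (transp i j hij x)) x
  /-- `s_ij s_jk s_ij x = s_ik x` -/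
  | transp_conj (i j k : I) (hij : i ≠ j) (hik : i ≠ k) (hjk : j ≠ k) :
      Ax I (transp i j hij (transp j k hjk (transp i j hij x))) (transp i k hik x)
  /-- `s_ij s_kl x = s_kl s_ij x` -/
  | transp_comm (i j k l : I) (hij : i ≠ j) (hik : i ≠ k) (hil : i ≠ l) (hjk : j ≠ k)
      (hjl : j ≠ l) (hkl : k ≠ l) :
      Ax I (transp i j hij (transp k l hkl x)) (transp k l hkl (transp i j hij x))
  -- the relations that involve replacements
  /-- `s_kl sʲᵢ s_kl x = sʲᵢ x` -/
  | conj_disjoint (i j k l : I) (hij : i ≠ j) (hik : i ≠ k) (hil : i ≠ l) (hjk : j ≠ k)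
      (hjl : j ≠ l) (hkl : k ≠ l) :
      Ax I (transp k l hkl (repl j i hij.symm (transp k l hkl x))) (repl j i hij.symm x)
  /-- `s_jk sʲᵢ s_jk x = sᵏᵢ x` -/
  | conj_upper (i j k : I) (hij : i ≠ j) (hik : i ≠ k) (hjk : j ≠ k) :
      Ax I (transp j k hjk (repl j i hij.symm (transp j k hjk x))) (repl k i hik.symm x)
  /-- `s_ki sʲᵢ s_ki x = sʲₖ x` -/
  | conj_lower (i j k : I) (hij : i ≠ j) (hik : i ≠ k) (hjk : j ≠ k) :
      Ax I (transp k i hik.symm (repl j i hij.symm (transp k i hik.symm x))) (repl j k hjk x)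
  /-- `s_ij sʲᵢ s_ij x = sⁱⱼ x` -/
  | conj_both (i j : I) (hij : i ≠ j) :
      Ax I (transp i j hij (repl j i hij.symm (transp i j hij x))) (repl i j hij x)
  /-- `sʲᵢ sᵏₗ x = sᵏₗ sʲᵢ x` -/
  | repl_comm_disjoint (i j k l : I) (hij : i ≠ j) (hik : i ≠ k) (hil : i ≠ l) (hjk : j ≠ k)
      (hjl : j ≠ l) (hkl : k ≠ l) :
      Ax I (repl j i hij.symm (repl k l hkl x)) (repl k l hkl (repl j i hij.symm x))
  /-- `sʲᵢ sᵏᵢ x = sᵏᵢ sʲᵢ x` -/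
  | repl_comm_lower (i j k : I) (hij : i ≠ j) (hik : i ≠ k) (hjk : j ≠ k) :
      Ax I (repl j i hij.symm (repl k i hik.symm x)) (repl k i hik.symm (repl j i hij.symm x))
  /-- `sᵏᵢ sʲᵢ x = sʲᵢ sᵏⱼ x` -/
  | repl_chain (i j k : I) (hij : i ≠ j) (hik : i ≠ k) (hjk : j ≠ k) :
      Ax I (repl k i hik.symm (repl j i hij.symm x)) (repl j i hij.symm (repl k j hjk.symm x))
  /-- `sʲᵢ sⁱₖ x = sʲₖ s_ij x` -/
  | repl_repl_transp (i j k : I) (hij : i ≠ j) (hik : i ≠ k) (hjk : j ≠ k) :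
      Ax I (repl j i hij.symm (repl i k hik x)) (repl j k hjk (transp i j hij x))
  /-- `sʲᵢ sʲₖ x = sʲₖ x` -/
  | repl_upper (i j k : I) (hij : i ≠ j) (hik : i ≠ k) (hjk : j ≠ k) :
      Ax I (repl j i hij.symm (repl j k hjk x)) (repl j k hjk x)
  /-- `sʲᵢ sʲᵢ x = sʲᵢ x` -/
  | repl_idem (i j : I) (hij : i ≠ j) :
      Ax I (repl j i hij.symm (repl j i hij.symm x)) (repl j i hij.symm x)
  /-- `sʲᵢ sⁱⱼ x = sʲᵢ x` -/
  | repl_swap (i j : I) (hij : i ≠ j) :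
      Ax I (repl j i hij.symm (repl i j hij x)) (repl j i hij.symm x)
  /-- `sʲᵢ s_ij x = sʲᵢ x` -/
  | repl_transp (i j : I) (hij : i ≠ j) :
      Ax I (repl j i hij.symm (transp i j hij x)) (repl j i hij.symm x)

/-- The set of equations `Σ_I`, an equation being a pair of terms. -/
def SigmaEqs (I : Type u) : Set (Tm I × Tm I) := {e | Ax I e.1 e.2}

/-- The class of all algebras in which every equation of `E` is valid. -/
def Mod {I : Type u} (E : Set (Tm I × Tm I)) : Set (Alg.{u} I) :=
  {A | ∀ e ∈ E, ∀ v : ℕ → A, e.1.realize v = e.2.realize v}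

/-- `SA_I = Mod(Σ_I)`. -/
def SA (I : Type u) : Set (Alg.{u} I) := Mod (SigmaEqs I)

/-! ### Varieties -/

/-- The direct product of a family of algebras, with pointwise operations. -/
def prod {I : Type u} {J : Type u} (A : J → Alg.{u} I) : Alg.{u} I where
  carrier := ∀ j, A j
  str :=
    { funMap := fun f a j => FirstOrder.Language.Structure.funMap f fun n => a n j
      RelMap := fun r _ => r.elim }

/-- A variety: a class of algebras closed under homomorphic images, (isomorphic copies of)
subalgebras, and direct products. -/
structure IsVariety {I : Type u} (K : Set (Alg.{u} I)) : Prop where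
  image : ∀ A ∈ K, ∀ B : Alg.{u} I, ∀ f : A →[lang I] B, Function.Surjective f → B ∈ K
  sub : ∀ B ∈ K, ∀ A : Alg.{u} I, ∀ f : A →[lang I] B, Function.Injective f → A ∈ K
  prod : ∀ (J : Type u) (A : J → Alg.{u} I), (∀ j, A j ∈ K) → prod A ∈ K

/-- The variety generated by `K`: the smallest variety that includes `K`. -/
def generatedVariety {I : Type u} (K : Set (Alg.{u} I)) : Set (Alg.{u} I) :=
  ⋂₀ {W | IsVariety W ∧ K ⊆ W}

/-! ### Locally square set algebras -/

open Classical in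
/-- The replacement `[i|j]`, which takes `i` to `j` and fixes everything else. -/
noncomputable def replMap {I : Type u} (i j : I) : I → I := Function.update id i j

open Classical in
/-- The transposition `[i,j]`. -/
noncomputable def transpMap {I : Type u} (i j : I) : I → I := Equiv.swap i j

/-- The weak set `ᴵI^(Id)`: the maps that differ from the identity at finitely many points. -/
def weakSet (I : Type u) : Set (I → I) := {s | {i | s i ≠ i}.Finite}

/-- `V` is locally square: it is closed under `s ↦ s ∘ [i|j]` and `s ↦ s ∘ [i,j]`. -/
def LocallySquare {I : Type u} (V : Set (I → I)) : Prop :=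
  ∀ s ∈ V, ∀ i j : I, s ∘ replMap i j ∈ V ∧ s ∘ transpMap i j ∈ V

/-- `{q ∈ V : q ∘ σ ∈ X}` for a subset `X` of `V`. -/
def setSubst {I : Type u} {V : Set (I → I)} (σ : I → I) (X : Set V) : Set V :=
  {q | ∃ p ∈ X, (p : I → I) = (q : I → I) ∘ σ}

/-- The operations of `℘(V)`. -/
def setOp {I : Type u} (V : Set (I → I)) : {n : ℕ} → Op I n → (Fin n → Set V) → Set V
  | _, .meet, X => X 0 ∩ X 1
  | _, .compl, X => (X 0)ᶜ
  | _, .repl i j _, X => setSubst (replMap i j) (X 0)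
  | _, .transp i j _, X => setSubst (transpMap i j) (X 0)

/-- The set algebra `℘(V) = ⟨𝒫(V), ∩, ∼, Sⁱⱼ, S_ij⟩`, with `Sⁱⱼ X = {q ∈ V : q ∘ [i|j] ∈ X}` and
`S_ij X = {q ∈ V : q ∘ [i,j] ∈ X}`. -/
def setAlg {I : Type u} (V : Set (I → I)) : Alg.{u} I where
  carrier := Set V
  str :=
    { funMap := fun f X => setOp V f X
      RelMap := fun r _ => r.elim }

/-- `WSA_I`, the variety generated by the algebras `℘(V)` with `V ⊆ ᴵI^(Id)` locally square. -/
def WSA (I : Type u) : Set (Alg.{u} I) :=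
  generatedVariety {A | ∃ V : Set (I → I), V ⊆ weakSet I ∧ LocallySquare V ∧ A = setAlg V}

/-! ### Superamalgamation -/

/-- The Boolean order of an algebra: `a ≤ b` iff `a · b = a`. -/
def le {I : Type u} {A : Alg.{u} I} (a b : A) : Prop :=
  FirstOrder.Language.Structure.funMap (L := lang I) (n := 2) Op.meet ![a, b] = a

/-- The superamalgamation property of a class of algebras. -/
def HasSuperamalgamation {I : Type u} (K : Set (Alg.{u} I)) : Prop :=
  ∀ A ∈ K, ∀ B ∈ K, ∀ C ∈ K, ∀ (f : A →[lang I] B) (g : A →[lang I] C),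
    Function.Injective f → Function.Injective g →
    ∃ D ∈ K, ∃ (m : B →[lang I] D) (n : C →[lang I] D),
      Function.Injective m ∧ Function.Injective n ∧ (∀ a : A, m (f a) = n (g a)) ∧
      (∀ (b : B) (c : C), le (m b) (n c) → ∃ a : A, le b (f a) ∧ le (g a) c) ∧
      (∀ (b : B) (c : C), le (n c) (m b) → ∃ a : A, le c (g a) ∧ le (f a) b)

end SubstAlg

/-! Both parts rest on viewing the operations of an algebra as Boolean endomorphisms that satisfy
the relations collected in `IsSubstRep`.

For (1), soundness (`setAlg_mem_SA`) holds because replacements and transpositions of `I` satisfy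
those relations under composition. The converse needs the presentation theorem `SubstWord.unique`:
in any monoid with these relations, the value of a word in the letters `r i j`, `t i j` depends only
on the map `τ` that the word denotes. Given this, every such `τ` acts on `A` by a well-defined
endomorphism, and an ultrafilter `F` yields the homomorphism taking `a` to the set of all `τ` that
send `a` into `F`. All ultrafilters together embed `A` into a power of one `℘(V)` (`SA_subset_WSA`).

The presentation theorem is a normal-form argument. Choose representatives `ε x` of the kernel
classes of `τ`, moving only finitely many `x`, and let `e` be the product of the letters `r x (ε x)`
over these `x`. Words with map `τ` absorb `e` on the right (`mul_repl_eq`), and the moved indices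
are dead for `e` (`isDead_prod`). Up to dead indices `τ` is injective, so before `e` a word acts
like a word in transpositions (`exists_transpWord`). Two such words with the same map off the dead
indices differ by a permutation of dead indices, which `e` absorbs (`TranspWord.mul_eq_of_isDead`).

For (2), Stone duality turns the amalgam into a pullback: the points are pairs of ultrafilters of
`B` and `C` with the same trace on `A`, the operations act by preimage, and `D` consists of all sets
of points. If no element of `A` interpolates between `b` and `c`, compactness gives a pair that
contains `b` and omits `c` (`exists_ult_of_no_interpolant`). -/

namespace SubstAlg

/-! ### Replacements and transpositions as maps -/

section Maps

variable {I : Type u}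

theorem replMap_self_apply (i j : I) : replMap i j i = j := by simp [replMap]

open Classical in
theorem replMap_of_ne {i x : I} (j : I) (h : x ≠ i) : replMap i j x = x := by
  simp [replMap, Function.update_of_ne h]

theorem replMap_self (i : I) : replMap i i = id := by
  funext x; by_cases h : x = i <;> simp [replMap, h]

theorem transpMap_left (i j : I) : transpMap i j i = j := by simp [transpMap]

theorem transpMap_right (i j : I) : transpMap i j j = i := by simp [transpMap]

open Classical in
theorem transpMap_of_ne {i j x : I} (hi : x ≠ i) (hj : x ≠ j) : transpMap i j x = x := by
  simp [transpMap, Equiv.swap_apply_of_ne_of_ne hi hj]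

theorem transpMap_self (i : I) : transpMap i i = id := by
  funext x; simp [transpMap]

theorem transpMap_comm (i j : I) : transpMap i j = transpMap j i := by
  simp [transpMap, Equiv.swap_comm]

theorem transpMap_transpMap (i j x : I) : transpMap i j (transpMap i j x) = x := by
  simp [transpMap]

theorem transpMap_comp_self (i j : I) : transpMap i j ∘ transpMap i j = id :=
  funext (transpMap_transpMap i j)

theorem transpMap_injective (i j : I) : Function.Injective (transpMap i j) :=
  (show Function.Involutive _ from transpMap_transpMap i j).injective

open Classical in
theorem replMap_apply (i j x : I) : replMap i j x = if x = i then j else x := by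
  simp [replMap, Function.update_apply]

open Classical in
theorem transpMap_apply (i j x : I) :
    transpMap i j x = if x = i then j else if x = j then i else x := by
  simp [transpMap, Equiv.swap_apply_def]

end Maps

/-! ### The defining relations in a monoid -/

/-- Elements `r i j` and `t i j` of a monoid that satisfy the relations which `Σ_I` imposes on the
operations `sⁱⱼ` and `s_ij`. On the diagonal both are the unit. -/
structure IsSubstRep {I : Type*} {M : Type*} [Monoid M] (r t : I → I → M) : Prop where
  repl_self (i : I) : r i i = 1
  transp_self (i : I) : t i i = 1
  transp_symm (i j : I) : i ≠ j → t i j = t j i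
  transp_transp (i j : I) : i ≠ j → t i j * t i j = 1
  transp_conj (i j k : I) : i ≠ j → i ≠ k → j ≠ k → t i j * (t j k * t i j) = t i k
  transp_comm (i j k l : I) : i ≠ j → i ≠ k → i ≠ l → j ≠ k → j ≠ l → k ≠ l →
    t i j * t k l = t k l * t i j
  conj_disjoint (i j k l : I) : i ≠ j → i ≠ k → i ≠ l → j ≠ k → j ≠ l → k ≠ l →
    t k l * (r j i * t k l) = r j i
  conj_upper (i j k : I) : i ≠ j → i ≠ k → j ≠ k → t j k * (r j i * t j k) = r k i
  conj_lower (i j k : I) : i ≠ j → i ≠ k → j ≠ k → t k i * (r j i * t k i) = r j k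
  conj_both (i j : I) : i ≠ j → t i j * (r j i * t i j) = r i j
  repl_comm_disjoint (i j k l : I) : i ≠ j → i ≠ k → i ≠ l → j ≠ k → j ≠ l → k ≠ l →
    r j i * r k l = r k l * r j i
  repl_comm_lower (i j k : I) : i ≠ j → i ≠ k → j ≠ k → r j i * r k i = r k i * r j i
  repl_chain (i j k : I) : i ≠ j → i ≠ k → j ≠ k → r k i * r j i = r j i * r k j
  repl_repl_transp (i j k : I) : i ≠ j → i ≠ k → j ≠ k → r j i * r i k = r j k * t i j
  repl_upper (i j k : I) : i ≠ j → i ≠ k → j ≠ k → r j i * r j k = r j k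
  repl_idem (i j : I) : i ≠ j → r j i * r j i = r j i
  repl_swap (i j : I) : i ≠ j → r j i * r i j = r j i
  repl_transp (i j : I) : i ≠ j → r j i * t i j = r j i

/-- Used for the soundness of the axioms in `℘(V)` and for the map side of `TranspWord.of_insert`.
Multiplication in `Function.End` is composition, so the rightmost letter acts first. -/
theorem isSubstRep_maps (I : Type u) :
    IsSubstRep (M := Function.End I) (replMap (I := I)) (transpMap (I := I)) := by
  have mul_apply (f g : I → I) (x : I) :
      (HMul.hMul (α := Function.End I) (β := Function.End I) f g : I → I) x = f (g x) := rfl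
  have mul_mul_apply (f g h : I → I) (x : I) :
      (HMul.hMul (α := Function.End I) (β := Function.End I) f
        (HMul.hMul (α := Function.End I) (β := Function.End I) g h) : I → I) x = f (g (h x)) := rfl
  have one_apply (x : I) : (1 : Function.End I) x = x := rfl
  constructor <;> intros
  case repl_self => exact replMap_self _
  case transp_self => exact transpMap_self _
  all_goals
    refine funext fun x => ?_
    simp only [mul_mul_apply, mul_apply, one_apply, replMap_apply, transpMap_apply]
    grind

namespace IsSubstRep

variable {I : Type u} {M : Type*} [Monoid M] {r t : I → I → M} (h : IsSubstRep r t)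
include h

theorem transp_symm' (i j : I) : t i j = t j i := by
  by_cases hij : i = j
  · rw [hij]
  · exact h.transp_symm i j hij

theorem transp_mul_self (i j : I) : t i j * t i j = 1 := by
  by_cases hij : i = j
  · rw [hij, h.transp_self, one_mul]
  · exact h.transp_transp i j hij

theorem transp_mul_cancel (i j : I) (m : M) : t i j * (t i j * m) = m := by
  rw [← mul_assoc, h.transp_mul_self, one_mul]

theorem eq_mul_transp_of_conj {i j : I} {a b : M} (hab : t i j * (a * t i j) = b) :
    t i j * a = b * t i j := by
  rw [← hab, mul_assoc, mul_assoc, h.transp_mul_self, mul_one]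

/-- The relations among transpositions, with all coincidences of indices, amount to this single
conjugation rule. -/
theorem transp_mul_transp (i j a b : I) :
    t i j * t a b = t (transpMap i j a) (transpMap i j b) * t i j := by
  by_cases hij : i = j
  · subst hij; simp [transpMap_self, h.transp_self]
  by_cases hab : a = b
  · subst hab; simp [h.transp_self]
  have key : ∀ i j b : I, i ≠ j → i ≠ b → j ≠ b → t i j * t i b = t j b * t i j := by
    intro i j b hij hib hjb
    rw [h.transp_symm' i j]
    exact h.eq_mul_transp_of_conj (h.transp_conj j i b hij.symm hjb hib)
  by_cases hai : a = i
  · subst hai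
    by_cases hbj : b = j
    · subst hbj
      rw [transpMap_left, transpMap_right, h.transp_symm' b a]
    · rw [transpMap_left, transpMap_of_ne (Ne.symm hab) hbj]
      exact key a j b hij hab (Ne.symm hbj)
  by_cases haj : a = j
  · subst haj
    by_cases hbi : b = i
    · subst hbi
      rw [transpMap_left, transpMap_right, h.transp_symm' b a]
    · rw [transpMap_right, transpMap_of_ne hbi (Ne.symm hab), h.transp_symm' i a]
      exact key a i b hai hab (Ne.symm hbi)
  rw [transpMap_of_ne hai haj]
  by_cases hbi : b = i
  · subst hbi
    rw [transpMap_left, h.transp_symm' a b, h.transp_symm' a j]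
    exact key b j a hij (Ne.symm hai) (Ne.symm haj)
  by_cases hbj : b = j
  · subst hbj
    rw [transpMap_right, h.transp_symm' i b, h.transp_symm' a b, h.transp_symm' a i]
    exact key b i a (Ne.symm hij) (Ne.symm haj) (Ne.symm hai)
  rw [transpMap_of_ne hbi hbj]
  exact h.transp_comm i j a b hij (Ne.symm hai) (Ne.symm hbi) (Ne.symm haj) (Ne.symm hbj) hab

theorem transp_mul_repl (i j a b : I) :
    t i j * r a b = r (transpMap i j a) (transpMap i j b) * t i j := by
  by_cases hij : i = j
  · subst hij; simp [transpMap_self, h.transp_self]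
  by_cases hab : a = b
  · subst hab; simp [h.repl_self]
  by_cases hai : a = i
  · subst hai
    by_cases hbj : b = j
    · subst hbj
      rw [transpMap_left, transpMap_right, h.transp_symm' a b]
      exact h.eq_mul_transp_of_conj (h.conj_both b a (Ne.symm hab))
    · rw [transpMap_left, transpMap_of_ne (Ne.symm hab) hbj]
      exact h.eq_mul_transp_of_conj (h.conj_upper b a j (Ne.symm hab) hbj hij)
  by_cases haj : a = j
  · subst haj
    by_cases hbi : b = i
    · subst hbi
      rw [transpMap_left, transpMap_right]
      exact h.eq_mul_transp_of_conj (h.conj_both b a (Ne.symm hab))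
    · rw [transpMap_right, transpMap_of_ne hbi (Ne.symm hab), h.transp_symm' i a]
      exact h.eq_mul_transp_of_conj (h.conj_upper b a i (Ne.symm hab) hbi hai)
  rw [transpMap_of_ne hai haj]
  by_cases hbi : b = i
  · subst hbi
    rw [transpMap_left, h.transp_symm' b j]
    exact h.eq_mul_transp_of_conj (h.conj_lower b a j (Ne.symm hab) hij haj)
  by_cases hbj : b = j
  · subst hbj
    rw [transpMap_right]
    exact h.eq_mul_transp_of_conj (h.conj_lower b a i (Ne.symm hab) hbi hai)
  rw [transpMap_of_ne hbi hbj]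
  exact h.eq_mul_transp_of_conj
    (h.conj_disjoint b a i j (Ne.symm hab) hbi hbj hai haj hij)

theorem repl_mul_repl_same (a b c : I) (hca : c ≠ a) : r a b * r a c = r a c := by
  by_cases hab : a = b
  · rw [hab, h.repl_self, one_mul]
  by_cases hbc : b = c
  · subst hbc; exact h.repl_idem b a (Ne.symm hab)
  · exact h.repl_upper b a c (Ne.symm hab) hbc (Ne.symm hca)

theorem repl_comm {a b x y : I} (hax : a ≠ x) (hya : y ≠ a) (hbx : b ≠ x) :
    r a b * r x y = r x y * r a b := by
  by_cases hab : a = b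
  · rw [hab, h.repl_self, one_mul, mul_one]
  by_cases hxy : x = y
  · rw [hxy, h.repl_self, one_mul, mul_one]
  by_cases hby : b = y
  · subst hby; exact h.repl_comm_lower b a x hya hbx hax
  · exact h.repl_comm_disjoint b a x y (Ne.symm hab) hbx hby hax (Ne.symm hya) hxy

/-- The program `a := b; x := a` has the same effect as `x := b; a := b`. -/
theorem repl_mul_repl_chain {a b x : I} (hax : a ≠ x) (hbx : b ≠ x) :
    r a b * r x a = r x b * r a b := by
  by_cases hab : a = b
  · rw [hab, h.repl_self, one_mul, mul_one]
  · exact (h.repl_chain b a x (Ne.symm hab) hbx hax).symm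

end IsSubstRep

/-! ### Dead indices -/

/-- An index `a` is dead for `e` if replacing it before `e` has no effect. -/
def IsDead {I M : Type*} [Monoid M] (r : I → I → M) (e : M) (a : I) : Prop := ∀ b, r a b * e = e

namespace IsSubstRep

variable {I : Type u} {M : Type*} [Monoid M] {r t : I → I → M} (h : IsSubstRep r t)
include h

/-- For maps, a dead index is one outside the range. Here every listed index is sent outside the
list, so the product hits none of them; the induction derives this from the relations. -/
theorem isDead_prod (ε : I → I) : ∀ l : List I, (∀ x ∈ l, ∀ y ∈ l, ε x ≠ y) →
    ∀ a ∈ l, IsDead r ((l.map fun x => r x (ε x)).prod) a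
  | [], _, a, ha => by simp at ha
  | x :: l, hl, a, ha => by
    intro b
    have hl' : ∀ x ∈ l, ∀ y ∈ l, ε x ≠ y := fun y hy z hz =>
      hl y (List.mem_cons_of_mem _ hy) z (List.mem_cons_of_mem _ hz)
    rw [List.map_cons, List.prod_cons]
    by_cases hax : a = x
    · subst hax
      rw [← mul_assoc, h.repl_mul_repl_same a b _ (hl a ha a ha)]
    have hal : a ∈ l := (List.mem_cons.1 ha).resolve_left hax
    have ih := isDead_prod ε l hl' a hal
    generalize (l.map fun x => r x (ε x)).prod = e at ih
    have hεa : ε x ≠ a := hl x List.mem_cons_self a ha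
    have hεx : ε x ≠ x := hl x List.mem_cons_self x List.mem_cons_self
    by_cases hbx : b = x
    · subst hbx
      -- Since `a` is dead for the tail, `r a (ε b)` can be inserted there and commuted to the
      -- front, where it absorbs `r a b`.
      have h1 : r b (ε b) * e = r a (ε b) * (r b (ε b) * e) := by
        conv_lhs => rw [← ih (ε b)]
        rw [← mul_assoc, ← mul_assoc, h.repl_comm (Ne.symm hax) hεx hεa]
      rw [h1, ← mul_assoc, h.repl_mul_repl_same a b _ hεa]
    · rw [← mul_assoc, h.repl_comm hax hεa hbx, mul_assoc, ih b]

theorem isDead_transp_mul {e : M} {a : I} (i j : I) (ha : IsDead r e a) :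
    IsDead r (t i j * e) (transpMap i j a) := by
  intro b
  have := h.transp_mul_repl i j a (transpMap i j b)
  rw [transpMap_transpMap] at this
  rw [← mul_assoc, ← this, mul_assoc, ha]

variable [Infinite I]

/-- The maps `[a|b]` and `[a,b]` differ only at `b`, which the range of `e` avoids. The relation
that shows this abstractly involves a third index `c`; infinitude of `I` supplies it. -/
theorem repl_mul_eq_transp_mul {e : M} {a b : I} (hb : IsDead r e b) :
    r a b * e = t a b * e := by
  by_cases hab : a = b
  · rw [hab, h.repl_self, h.transp_self]
  obtain ⟨c, hc⟩ := Set.Infinite.nonempty (Set.infinite_univ (α := I) |>.sdiff (Set.toFinite {a, b}))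
  simp only [Set.mem_sdiff, Set.mem_univ, true_and, Set.mem_insert_iff, Set.mem_singleton_iff,
    not_or] at hc
  have h1 : t a b * r b c = r a b * r b c := by
    rw [h.transp_mul_repl, transpMap_right, transpMap_of_ne hc.1 hc.2,
      h.repl_repl_transp b a c (Ne.symm hab) (Ne.symm hc.2) (Ne.symm hc.1), h.transp_symm' a b]
  rw [← hb c, ← mul_assoc, ← mul_assoc, h1]

theorem transp_mul_of_isDead {e : M} {a b : I} (ha : IsDead r e a) (hb : IsDead r e b) :
    t a b * e = e := by
  rw [← h.repl_mul_eq_transp_mul hb, ha]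

end IsSubstRep

/-! ### Words in transpositions -/

/-- `TranspWord t S p m` says that some word in the transpositions of members of `S` has the value
`p` as a map and the value `m` in the monoid. -/
inductive TranspWord {I : Type u} {M : Type*} [Monoid M] (t : I → I → M) (S : Set I) :
    (I → I) → M → Prop
  | one : TranspWord t S id 1
  | mul_transp {p m i j} (w : TranspWord t S p m) (hi : i ∈ S) (hj : j ∈ S) :
      TranspWord t S (p ∘ transpMap i j) (m * t i j)

namespace TranspWord

variable {I : Type u} {M : Type*} [Monoid M] {r t : I → I → M} {S : Set I}

theorem mul {p q : I → I} {m n : M} (hp : TranspWord t S p m) (hq : TranspWord t S q n) :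
    TranspWord t S (p ∘ q) (m * n) := by
  induction hq with
  | one => simpa using hp
  | mul_transp _ hi hj ih => rw [← mul_assoc]; exact ih.mul_transp hi hj

theorem transp {i j : I} (hi : i ∈ S) (hj : j ∈ S) :
    TranspWord t S (transpMap i j) (t i j) := by
  simpa using (TranspWord.one (t := t)).mul_transp hi hj

theorem injective {p : I → I} {m : M} (hp : TranspWord t S p m) : Function.Injective p := by
  induction hp with
  | one => exact Function.injective_id
  | mul_transp _ _ _ ih => exact ih.comp (transpMap_injective _ _)

theorem apply_of_notMem {p : I → I} {m : M} (hp : TranspWord t S p m) {x : I} (hx : x ∉ S) :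
    p x = x := by
  induction hp with
  | one => rfl
  | mul_transp _ hi hj ih =>
    rw [Function.comp_apply, transpMap_of_ne (ne_of_mem_of_not_mem hi hx).symm (ne_of_mem_of_not_mem hj hx).symm,
      ih]

theorem mono {S' : Set I} (hS : S ⊆ S') {p : I → I} {m : M} (hp : TranspWord t S p m) :
    TranspWord t S' p m := by
  induction hp with
  | one => exact .one
  | mul_transp _ hi hj ih => exact ih.mul_transp (hS hi) (hS hj)

theorem exists_finite {p : I → I} {m : M} (hp : TranspWord t S p m) :
    ∃ F : Set I, F.Finite ∧ TranspWord t F p m := by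
  induction hp with
  | one => exact ⟨∅, Set.finite_empty, .one⟩
  | @mul_transp p m i j _ _ _ ih =>
    obtain ⟨F, hF, H⟩ := ih
    exact ⟨insert i (insert j F), (hF.insert _).insert _,
      (H.mono fun x hx => .inr (.inr hx)).mul_transp (by simp) (by simp)⟩

variable (h : IsSubstRep r t)
include h

theorem exists_inverse {p : I → I} {m : M} (hp : TranspWord t S p m) :
    ∃ q n, TranspWord t S q n ∧ q ∘ p = id ∧ n * m = 1 ∧ m * n = 1 := by
  induction hp with
  | one => exact ⟨id, 1, .one, rfl, one_mul 1, one_mul 1⟩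
  | @mul_transp p m i j _ hi hj ih =>
    obtain ⟨q, n, hq, hqp, hnm, hmn⟩ := ih
    refine ⟨_, _, (transp hi hj).mul hq, ?_, ?_, ?_⟩
    · rw [Function.comp_assoc, ← Function.comp_assoc q, hqp, Function.id_comp,
        transpMap_comp_self]
    · rw [mul_assoc, ← mul_assoc n, hnm, one_mul, h.transp_mul_self]
    · rw [mul_assoc, h.transp_mul_cancel, hmn]

/-- Coset decomposition of the symmetric group on `insert a S` modulo the one on `S`: the index `a`
can be confined to at most one letter, at the right end. -/
theorem of_insert {a : I} (ha : a ∉ S) {p : I → I} {m : M}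
    (hp : TranspWord t (insert a S) p m) :
    ∃ q n, TranspWord t S q n ∧
      ((p = q ∧ m = n) ∨ ∃ b ∈ S, p = q ∘ transpMap a b ∧ m = n * t a b) := by
  have hI := isSubstRep_maps I
  induction hp with
  | one => exact ⟨id, 1, .one, .inl ⟨rfl, rfl⟩⟩
  | @mul_transp p m x y _ hx hy ih =>
    obtain ⟨q, n, hq, ih⟩ := ih
    have special : ∀ c ∈ S, ∃ q n, TranspWord t S q n ∧
        ((p ∘ transpMap a c = q ∧ m * t a c = n) ∨
          ∃ b ∈ S, p ∘ transpMap a c = q ∘ transpMap a b ∧ m * t a c = n * t a b) := by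
      intro c hc
      rcases ih with ⟨rfl, rfl⟩ | ⟨b, hb, rfl, rfl⟩
      · exact ⟨_, _, hq, .inr ⟨c, hc, rfl, rfl⟩⟩
      · by_cases hbc : b = c
        · subst hbc
          refine ⟨_, _, hq, .inl ⟨?_, ?_⟩⟩
          · rw [Function.comp_assoc, transpMap_comp_self, Function.comp_id]
          · rw [mul_assoc, h.transp_mul_self, mul_one]
        -- Conjugation rewrites `t a b * t a c` as `t b c * t a b`, so `a` again occurs once.
        · have e1 : transpMap a b c = c :=
            transpMap_of_ne (fun e => ha (e ▸ hc)) (Ne.symm hbc)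
          refine ⟨_, _, hq.mul_transp hb hc, .inr ⟨b, hb, ?_, ?_⟩⟩
          · have := hI.transp_mul_transp a b a c
            rw [transpMap_left, e1] at this
            exact congrArg (q ∘ ·) this
          · rw [mul_assoc, h.transp_mul_transp, transpMap_left, e1, mul_assoc]
    by_cases hxa : x = a
    · subst hxa
      rcases Set.mem_insert_iff.1 hy with rfl | hy
      · rw [transpMap_self, h.transp_self, mul_one, Function.comp_id]
        exact ⟨q, n, hq, ih⟩
      · exact special y hy
    by_cases hya : y = a
    · subst hya
      rw [transpMap_comm, h.transp_symm']
      exact special x (hx.resolve_left hxa)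
    have hx := hx.resolve_left hxa
    have hy := hy.resolve_left hya
    rcases ih with ⟨rfl, rfl⟩ | ⟨b, hb, rfl, rfl⟩
    · exact ⟨_, _, hq.mul_transp hx hy, .inl ⟨rfl, rfl⟩⟩
    · have e1 : transpMap x y a = a := transpMap_of_ne (Ne.symm hxa) (Ne.symm hya)
      have hb' : transpMap x y b ∈ S := by
        rw [transpMap_apply]; split_ifs <;> assumption
      refine ⟨_, _, hq.mul_transp hx hy, .inr ⟨_, hb', ?_, ?_⟩⟩
      · have := hI.transp_mul_transp x y a (transpMap x y b)
        rw [transpMap_transpMap, e1] at this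
        exact congrArg (q ∘ ·) this.symm
      · have := h.transp_mul_transp x y a (transpMap x y b)
        rw [transpMap_transpMap, e1] at this
        rw [mul_assoc, mul_assoc, this]

/-- A word whose map fixes everything outside `X` can be rewritten without using indices outside
`X`. -/
theorem of_fixes {X : Set I} {F : Set I} (hF : F.Finite) :
    ∀ {p : I → I} {m : M}, TranspWord t (F ∪ X) p m → (∀ x ∉ X, p x = x) →
      TranspWord t X p m := by
  induction F, hF using Set.Finite.induction_on with
  | empty => intro p m hp _; simpa using hp
  | @insert a F _ _ ih =>
    intro p m hp hfix
    by_cases ha : a ∈ F ∪ X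
    · rw [Set.insert_union, Set.insert_eq_of_mem ha] at hp
      exact ih hp hfix
    rw [Set.insert_union] at hp
    obtain ⟨q, n, hq, ⟨rfl, rfl⟩ | ⟨b, hb, rfl, rfl⟩⟩ := of_insert h ha hp
    · exact ih hq hfix
    -- The map sends `a` to `q b`, which must be `a = q a`; injectivity of `q` then forces `b = a`.
    · exfalso
      have h1 := hfix a fun hx => ha (.inr hx)
      rw [Function.comp_apply, transpMap_left] at h1
      have h2 : b = a := hq.injective (h1.trans (hq.apply_of_notMem ha).symm)
      exact ha (h2 ▸ hb)

theorem mul_eq_of_isDead [Infinite I] {X : Set I} {e : M} (he : ∀ x ∈ X, IsDead r e x)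
    {p : I → I} {m : M} (hp : TranspWord t S p m) (hfix : ∀ x ∉ X, p x = x) : m * e = e := by
  obtain ⟨F, hF, hp'⟩ := hp.exists_finite
  have hX := of_fixes h hF (hp'.mono Set.subset_union_left) hfix
  clear hfix hp hp'
  induction hX with
  | one => exact one_mul e
  | mul_transp _ hi hj ih => rw [mul_assoc, h.transp_mul_of_isDead (he _ hi) (he _ hj), ih]

end TranspWord

/-! ### Words in replacements and transpositions -/

/-- `SubstWord r t τ m` says that some word in the replacements and the transpositions has the value
`τ` as a map and the value `m` in the monoid. -/
inductive SubstWord {I : Type u} {M : Type*} [Monoid M] (r t : I → I → M) :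
    (I → I) → M → Prop
  | one : SubstWord r t id 1
  | mul_repl {τ m} (i j) (w : SubstWord r t τ m) :
      SubstWord r t (τ ∘ replMap i j) (m * r i j)
  | mul_transp {τ m} (i j) (w : SubstWord r t τ m) :
      SubstWord r t (τ ∘ transpMap i j) (m * t i j)

namespace SubstWord

variable {I : Type u} {M : Type*} [Monoid M] {r t : I → I → M}

theorem mem_weakSet {τ : I → I} {m : M} (w : SubstWord r t τ m) : τ ∈ weakSet I := by
  induction w with
  | one => simp [weakSet]
  | mul_repl i j _ ih =>
    refine (Set.Finite.insert i ih).subset fun x hx => ?_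
    by_cases hxi : x = i
    · exact .inl hxi
    · rw [Set.mem_ofPred_eq, Function.comp_apply, replMap_of_ne j hxi] at hx
      exact .inr hx
  | mul_transp i j _ ih =>
    refine (Set.Finite.insert i (Set.Finite.insert j ih)).subset fun x hx => ?_
    by_cases hxi : x = i
    · exact .inl hxi
    by_cases hxj : x = j
    · exact .inr (.inl hxj)
    · rw [Set.mem_ofPred_eq, Function.comp_apply, transpMap_of_ne hxi hxj] at hx
      exact .inr (.inr hx)

variable (h : IsSubstRep r t)
include h

/-- Words absorb replacements inside the kernel of their map. The induction is on the last letter,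
past which `r x y` is moved until the shorter word can absorb it. -/
theorem mul_repl_eq {τ : I → I} {m : M} (w : SubstWord r t τ m) :
    ∀ x y, τ x = τ y → m * r x y = m := by
  induction w with
  | one => rintro x y (rfl : x = y); rw [h.repl_self, mul_one]
  | @mul_transp τ m a b _ ih =>
    intro x y hxy
    rw [mul_assoc, h.transp_mul_repl, ← mul_assoc, ih _ _ hxy]
  | @mul_repl τ m a b _ ih =>
    intro x y hxy
    by_cases hxy' : x = y
    · rw [hxy', h.repl_self, mul_one]
    by_cases hab : a = b
    · subst hab
      rw [replMap_self] at hxy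
      rw [h.repl_self, mul_one]
      exact ih x y hxy
    rw [Function.comp_apply, Function.comp_apply] at hxy
    by_cases hxa : x = a
    · subst hxa
      rw [replMap_self_apply, replMap_of_ne b (Ne.symm hxy')] at hxy
      rw [mul_assoc, h.repl_mul_repl_same x b y (Ne.symm hxy')]
      by_cases hby : b = y
      · rw [hby]
      -- The shorter word absorbs `r b y`, and in the presence of this factor `r x y` and `r x b`
      -- can be exchanged.
      · calc m * r x y = m * r b y * r x y := by rw [ih b y hxy]
          _ = m * (r b y * r x b) := by
            rw [mul_assoc, h.repl_mul_repl_chain (Ne.symm hab) (Ne.symm hxy'),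
              h.repl_comm (Ne.symm hab) (Ne.symm hby) (Ne.symm hxy')]
          _ = m * r x b := by rw [← mul_assoc, ih b y hxy]
    rw [replMap_of_ne b hxa] at hxy
    by_cases hya : y = a
    · subst hya
      rw [replMap_self_apply] at hxy
      by_cases hxb : x = b
      · subst hxb
        rw [mul_assoc, h.repl_swap x y hxa]
      · rw [mul_assoc, h.repl_mul_repl_chain (Ne.symm hxa) (Ne.symm hxb), ← mul_assoc,
          ih x b hxy]
    rw [replMap_of_ne b hya] at hxy
    by_cases hxb : x = b
    · subst hxb
      -- This and the chain relation give `m * r a x = m * r a y * r x y`, which absorbs `r x y` by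
      -- idempotence.
      have e1 : m * (r x y * r a x) = m * r a x := by rw [← mul_assoc, ih x y hxy]
      have e2 := h.repl_mul_repl_chain hxa hya
      calc m * r a x * r x y = m * (r x y * r a x) * r x y := by rw [e1]
        _ = m * (r a y * (r x y * r x y)) := by rw [e2, mul_assoc, mul_assoc]
        _ = m * r a x := by
          rw [h.repl_mul_repl_same x y y (Ne.symm hxy'), ← e2, e1]
    · rw [mul_assoc, h.repl_comm (Ne.symm hxa) hya (Ne.symm hxb), ← mul_assoc, ih x y hxy]

theorem mul_prod_eq {τ : I → I} {m : M} (w : SubstWord r t τ m) {ε : I → I}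
    (hε : ∀ x, τ (ε x) = τ x) : ∀ l : List I, m * (l.map fun x => r x (ε x)).prod = m
  | [] => by simp
  | x :: l => by
    rw [List.map_cons, List.prod_cons, ← mul_assoc, w.mul_repl_eq h _ _ (hε x).symm,
      mul_prod_eq w hε l]

/-- The inductive step for a transposition: the letter moves from the word into `e`, carrying the
dead set along. It is separate because the step for a replacement reduces to it. -/
theorem exists_transpWord_mul_transp {τ : I → I} {m : M} (a b : I)
    (H : ∀ (X : Set I) (e : M), (∀ x ∈ X, IsDead r e x) → Set.InjOn τ Xᶜ →
      ∃ p n, TranspWord t Set.univ p n ∧ Set.EqOn p τ Xᶜ ∧ m * e = n * e)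
    (X : Set I) (e : M) (he : ∀ x ∈ X, IsDead r e x) (hinj : Set.InjOn (τ ∘ transpMap a b) Xᶜ) :
    ∃ p n, TranspWord t Set.univ p n ∧ Set.EqOn p (τ ∘ transpMap a b) Xᶜ ∧
      m * t a b * e = n * e := by
  obtain ⟨p, n, hp, hpτ, hn⟩ := H (transpMap a b ⁻¹' X) (t a b * e)
    (fun x hx => by
      have := h.isDead_transp_mul a b (he _ hx)
      rwa [transpMap_transpMap] at this)
    (fun x hx y hy hxy => transpMap_injective a b
      (hinj hx hy (by simpa [transpMap_transpMap] using hxy)))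
  refine ⟨_, _, hp.mul_transp (Set.mem_univ a) (Set.mem_univ b), fun x hx => ?_, ?_⟩
  · refine hpτ (show transpMap a b (transpMap a b x) ∉ X from ?_)
    rwa [transpMap_transpMap]
  · rw [mul_assoc, hn, mul_assoc]

/-- Before indices that are dead for `e`, a word whose map is injective on the other indices acts
like a word in transpositions. -/
theorem exists_transpWord [Infinite I] {τ : I → I} {m : M} (w : SubstWord r t τ m) :
    ∀ (X : Set I) (e : M), (∀ x ∈ X, IsDead r e x) → Set.InjOn τ Xᶜ →
      ∃ p n, TranspWord t Set.univ p n ∧ Set.EqOn p τ Xᶜ ∧ m * e = n * e := by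
  induction w with
  | one => exact fun X e _ _ => ⟨id, 1, .one, fun _ _ => rfl, rfl⟩
  | @mul_transp τ m a b _ ih => exact exists_transpWord_mul_transp h a b ih
  | @mul_repl τ m a b _ ih =>
    intro X e he hinj
    by_cases haX : a ∈ X
    · have hτ : Set.EqOn (τ ∘ replMap a b) τ Xᶜ := fun x hx => by
        rw [Function.comp_apply, replMap_of_ne b (ne_of_mem_of_not_mem haX hx).symm]
      obtain ⟨p, n, hp, hpτ, hn⟩ := ih X e he ((Set.EqOn.injOn_iff hτ).1 hinj)
      exact ⟨p, n, hp, hpτ.trans hτ.symm, by rw [mul_assoc, he a haX, hn]⟩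
    by_cases hab : a = b
    · subst hab
      rw [replMap_self, Function.comp_id] at hinj ⊢
      rw [h.repl_self, mul_one]
      exact ih X e he hinj
    -- Were `a` and `b` both live, `τ ∘ [a|b]` would identify two live indices. So `b` is dead and
    -- the replacement acts as a transposition.
    have hbX : b ∈ X := by
      by_contra hbX
      refine hab (hinj haX hbX ?_)
      rw [Function.comp_apply, Function.comp_apply, replMap_self_apply,
        replMap_of_ne b (Ne.symm hab)]
    have hτ : Set.EqOn (τ ∘ replMap a b) (τ ∘ transpMap a b) Xᶜ := fun x hx => by
      by_cases hxa : x = a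
      · rw [hxa, Function.comp_apply, Function.comp_apply, replMap_self_apply, transpMap_left]
      · rw [Function.comp_apply, Function.comp_apply, replMap_of_ne b hxa,
          transpMap_of_ne hxa (ne_of_mem_of_not_mem hbX hx).symm]
    obtain ⟨p, n, hp, hpτ, hn⟩ :=
      exists_transpWord_mul_transp h a b ih X e he ((Set.EqOn.injOn_iff hτ).1 hinj)
    exact ⟨p, n, hp, hpτ.trans hτ.symm, by
      rw [mul_assoc, h.repl_mul_eq_transp_mul (he b hbX), ← mul_assoc, hn]⟩

/-- The presentation theorem: the value of a word in the monoid depends only on its map. -/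
theorem unique [Infinite I] {τ : I → I} {m n : M} (hm : SubstWord r t τ m)
    (hn : SubstWord r t τ n) : m = n := by
  have : Nonempty I := inferInstance
  obtain ⟨ε, hε, hετ, hfin⟩ : ∃ ε : I → I, (∀ x, τ (ε x) = τ x) ∧
      (∀ x y, τ x = τ y → ε x = ε y) ∧ {x | ε x ≠ x}.Finite := by
    -- The representative of a class depends only on the value of `τ`. If `x` is neither moved by
    -- `τ` nor the image of a moved point, its class is `{x}`; this bounds the support of `ε`.
    refine ⟨fun x => Function.invFun τ (τ x), fun x => Function.invFun_eq ⟨x, rfl⟩,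
      fun x y hxy => by simp only [hxy], ?_⟩
    have hS : {i | τ i ≠ i}.Finite := hm.mem_weakSet
    refine (hS.union (hS.image τ)).subset fun x hx => ?_
    by_contra hx'
    simp only [Set.mem_union, Set.mem_image, Set.mem_ofPred_eq, not_or, not_exists, not_and,
      not_not] at hx'
    have h1 : τ (Function.invFun τ (τ x)) = τ x := Function.invFun_eq ⟨x, rfl⟩
    change Function.invFun τ (τ x) ≠ x at hx
    generalize Function.invFun τ (τ x) = z at hx h1
    rw [hx'.1] at h1
    by_cases hz : τ z = z
    · exact hx (hz.symm.trans h1)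
    · exact hx'.2 z hz h1
  set X : Set I := {x | ε x ≠ x} with hX
  have hidem : ∀ x, ε (ε x) = ε x := fun x => hετ _ _ (hε x)
  let l := hfin.toFinset.toList
  have hl : ∀ x, x ∈ l ↔ ε x ≠ x := fun x => by simp [l, hX]
  let e := (l.map fun x => r x (ε x)).prod
  have hdead : ∀ x ∈ X, IsDead r e x := fun x hx =>
    h.isDead_prod ε l (fun x _ y hy hxy => (hl y).1 hy (hxy ▸ hidem x)) x ((hl x).2 hx)
  have hinj : Set.InjOn τ Xᶜ := fun x hx y hy hxy => by
    have hx : ε x = x := not_not.1 hx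
    have hy : ε y = y := not_not.1 hy
    rw [← hx, ← hy, hετ x y hxy]
  obtain ⟨p, m', hp, hpτ, hm'⟩ := exists_transpWord h hm X e hdead hinj
  obtain ⟨q, n', hq, hqτ, hn'⟩ := exists_transpWord h hn X e hdead hinj
  rw [mul_prod_eq h hm hε] at hm'
  rw [mul_prod_eq h hn hε] at hn'
  obtain ⟨q', k, hq', hqq', hkn, hnk⟩ := hq.exists_inverse h
  -- Both `p` and `q` agree with `τ` off `X`, so `q⁻¹p` moves dead indices only.
  have hk : k * m' * e = e := (hq'.mul hp).mul_eq_of_isDead h hdead fun x hx => by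
    rw [Function.comp_apply, hpτ hx, ← hqτ hx]
    exact congrFun hqq' x
  rw [hm', hn']
  calc m' * e = n' * (k * m' * e) := by rw [← mul_assoc, ← mul_assoc, hnk, one_mul]
    _ = n' * e := by rw [hk]

end SubstWord

/-! ### The operations of an algebra -/

section Operations

variable {I : Type u}

/-- The operation `·`. -/
def meetOp {A : Alg.{u} I} (a b : A) : A :=
  Language.Structure.funMap (L := lang I) (n := 2) Op.meet ![a, b]

/-- The operation `-`. -/
def complOp {A : Alg.{u} I} (a : A) : A :=
  Language.Structure.funMap (L := lang I) (n := 1) Op.compl ![a]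

open Classical in
/-- The operation `sⁱⱼ`, which is the identity if `i = j`. -/
noncomputable def replOp (A : Alg.{u} I) (i j : I) : Function.End A := fun a =>
  if h : i ≠ j then Language.Structure.funMap (L := lang I) (n := 1) (Op.repl i j h) ![a] else a

open Classical in
/-- The operation `s_ij`, which is the identity if `i = j`. -/
noncomputable def transpOp (A : Alg.{u} I) (i j : I) : Function.End A := fun a =>
  if h : i ≠ j then Language.Structure.funMap (L := lang I) (n := 1) (Op.transp i j h) ![a] else a

variable {A B : Alg.{u} I}

theorem replOp_of_ne {i j : I} (h : i ≠ j) (a : A) : replOp A i j a =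
    Language.Structure.funMap (L := lang I) (n := 1) (Op.repl i j h) ![a] := dif_pos h

theorem transpOp_of_ne {i j : I} (h : i ≠ j) (a : A) : transpOp A i j a =
    Language.Structure.funMap (L := lang I) (n := 1) (Op.transp i j h) ![a] := dif_pos h

theorem replOp_self (i : I) : replOp A i i = 1 := funext fun _ => dif_neg fun h => h rfl

theorem transpOp_self (i : I) : transpOp A i i = 1 := funext fun _ => dif_neg fun h => h rfl

variable (v : ℕ → A)

theorem realize_meet (s t : Tm I) :
    (s.meet t).realize v = meetOp (s.realize v) (t.realize v) :=
  congrArg _ (funext fun i => by fin_cases i <;> rfl)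

theorem realize_neg (s : Tm I) : s.neg.realize v = complOp (s.realize v) :=
  congrArg _ (funext fun i => by fin_cases i; rfl)

theorem realize_join (s t : Tm I) : (s.join t).realize v =
    complOp (meetOp (complOp (s.realize v)) (complOp (t.realize v))) := by
  rw [Tm.join, realize_neg, realize_meet, realize_neg, realize_neg]

theorem realize_repl (i j : I) (h : i ≠ j) (s : Tm I) :
    (s.repl i j h).realize v = replOp A i j (s.realize v) := by
  rw [replOp_of_ne h]
  exact congrArg _ (funext fun i => by fin_cases i; rfl)

theorem realize_transp (i j : I) (h : i ≠ j) (s : Tm I) :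
    (s.transp i j h).realize v = transpOp A i j (s.realize v) := by
  rw [transpOp_of_ne h]
  exact congrArg _ (funext fun i => by fin_cases i; rfl)

theorem realize_x : (Tm.x : Tm I).realize v = v 0 := rfl
theorem realize_y : (Tm.y : Tm I).realize v = v 1 := rfl
theorem realize_z : (Tm.z : Tm I).realize v = v 2 := rfl

variable (f : A →[lang I] B)

theorem map_meetOp (a b : A) : f (meetOp a b) = meetOp (f a) (f b) :=
  (f.map_fun _ _).trans (congrArg _ (funext fun i => by fin_cases i <;> rfl))

theorem map_complOp (a : A) : f (complOp a) = complOp (f a) :=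
  (f.map_fun _ _).trans (congrArg _ (funext fun i => by fin_cases i; rfl))

theorem map_replOp (i j : I) (a : A) : f (replOp A i j a) = replOp B i j (f a) := by
  by_cases h : i = j
  · rw [h, replOp_self, replOp_self]; rfl
  · rw [replOp_of_ne h, replOp_of_ne h]
    exact (f.map_fun _ _).trans (congrArg _ (funext fun i => by fin_cases i; rfl))

theorem map_transpOp (i j : I) (a : A) : f (transpOp A i j a) = transpOp B i j (f a) := by
  by_cases h : i = j
  · rw [h, transpOp_self, transpOp_self]; rfl
  · rw [transpOp_of_ne h, transpOp_of_ne h]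
    exact (f.map_fun _ _).trans (congrArg _ (funext fun i => by fin_cases i; rfl))

/-- A map that commutes with the operations is a homomorphism. -/
def homOfOps (f : A → B) (hmeet : ∀ a b, f (meetOp a b) = meetOp (f a) (f b))
    (hcompl : ∀ a, f (complOp a) = complOp (f a))
    (hrepl : ∀ i j, i ≠ j → ∀ a, f (replOp A i j a) = replOp B i j (f a))
    (htransp : ∀ i j, i ≠ j → ∀ a, f (transpOp A i j a) = transpOp B i j (f a)) :
    A →[lang I] B where
  toFun := f
  map_fun' := fun {n} o x => by
    have h1 : ∀ y : Fin 1 → A, y = ![y 0] := fun y => funext fun i => by fin_cases i; rfl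
    have h1' : ∀ y : Fin 1 → A, f ∘ y = ![f (y 0)] := fun y => funext fun i => by
      fin_cases i; rfl
    have h2 : ∀ y : Fin 2 → A, y = ![y 0, y 1] := fun y => funext fun i => by
      fin_cases i <;> rfl
    have h2' : ∀ y : Fin 2 → A, f ∘ y = ![f (y 0), f (y 1)] := fun y => funext fun i => by
      fin_cases i <;> rfl
    cases o with
    | meet => rw [h2' x, h2 x]; exact hmeet _ _
    | compl => rw [h1' x, h1 x]; exact hcompl _
    | repl i j h =>
      have := hrepl i j h (x 0)
      rw [replOp_of_ne h, replOp_of_ne h] at this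
      rw [h1' x, h1 x]; exact this
    | transp i j h =>
      have := htransp i j h (x 0)
      rw [transpOp_of_ne h, transpOp_of_ne h] at this
      rw [h1' x, h1 x]; exact this
  map_rel' := fun r _ => r.elim

end Operations

/-! ### The class `SA` is a variety -/

section Variety

variable {I : Type u}

/-- The projections of a direct product. -/
def projHom {J : Type u} (A : J → Alg.{u} I) (j : J) : prod A →[lang I] A j where
  toFun a := a j
  map_fun' _ _ := rfl
  map_rel' r _ := r.elim

theorem isVariety_Mod (E : Set (Tm I × Tm I)) : IsVariety (Mod E) where
  image A hA B f hf e he v := by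
    obtain ⟨w, rfl⟩ : ∃ w : ℕ → A, f ∘ w = v :=
      ⟨fun n => (hf (v n)).choose, funext fun n => (hf (v n)).choose_spec⟩
    rw [Language.HomClass.realize_term, Language.HomClass.realize_term, hA e he]
  sub B hB A f hf e he v := hf (by
    rw [← Language.HomClass.realize_term, ← Language.HomClass.realize_term, hB e he])
  prod J A hA e he v := funext fun j => by
    change projHom A j _ = projHom A j _
    rw [← Language.HomClass.realize_term, ← Language.HomClass.realize_term, hA j e he]

end Variety

/-! ### The Boolean structure of the members of `SA` -/

section Boolean

variable {I : Type u} {A : Alg.{u} I}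

/-- The valuation of the variables `v₀`, `v₁` and `v₂`. -/
def val (a b c : A) : ℕ → A
  | 0 => a
  | 1 => b
  | _ => c

theorem Ax.realize_eq (hA : A ∈ SA I) {s t : Tm I} (h : Ax I s t) (v : ℕ → A) :
    s.realize v = t.realize v := hA (s, t) h v

/-- The Boolean algebra structure of a member of `SA`. -/
noncomputable abbrev boolAlg (hA : A ∈ SA I) : BooleanAlgebra A :=
  letI : Max A := ⟨fun a b => complOp (meetOp (complOp a) (complOp b))⟩
  letI : Min A := ⟨meetOp⟩
  have comm (a b : A) : a ⊔ b = b ⊔ a := by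
    have := Ax.join_comm.realize_eq hA (val a b b)
    simp only [realize_join, realize_x, realize_y] at this
    exact this
  have comm' (a b : A) : a ⊓ b = b ⊓ a := by
    have := Ax.meet_comm.realize_eq hA (val a b b)
    simp only [realize_meet, realize_x, realize_y] at this
    exact this
  have absorb (a b : A) : a ⊔ a ⊓ b = a := by
    have := Ax.join_meet_absorb.realize_eq hA (val a b b)
    simp only [realize_meet, realize_join, realize_x, realize_y] at this
    exact this
  letI L : Lattice A := Lattice.mk' comm
    (fun a b c => by
      have := Ax.join_assoc.realize_eq hA (val a b c)
      simp only [realize_join, realize_x, realize_y, realize_z] at this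
      exact this.symm)
    comm'
    (fun a b c => by
      have := Ax.meet_assoc.realize_eq hA (val a b c)
      simp only [realize_meet, realize_x, realize_y, realize_z] at this
      exact this.symm)
    absorb
    (fun a b => by
      have := Ax.meet_join_absorb.realize_eq hA (val a b b)
      simp only [realize_meet, realize_join, realize_x, realize_y] at this
      exact this)
  have le_def (a b : A) : a ≤ b ↔ a ⊔ b = b := Iff.rfl
  have join_zero (a b : A) : b ⊔ (a ⊓ complOp a) = b := by
    have := Ax.join_zero.realize_eq hA (val a b b)
    simp only [Tm.zero, realize_meet, realize_neg, realize_join, realize_x, realize_y] at this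
    exact this
  have meet_one (a b : A) : b ⊓ (a ⊔ complOp a) = b := by
    have := Ax.meet_one.realize_eq hA (val a b b)
    simp only [Tm.one, realize_meet, realize_neg, realize_join, realize_x, realize_y] at this
    exact this
  have zero_le (a b : A) : a ⊓ complOp a ≤ b := (le_def _ _).2 ((comm _ _).trans (join_zero a b))
  have le_one (a b : A) : b ≤ a ⊔ complOp a := inf_eq_left.1 (meet_one a b)
  letI D : DistribLattice A := DistribLattice.ofInfSupLe fun a b c => le_of_eq (by
    have := Ax.meet_join_distrib.realize_eq hA (val a b c)
    simp only [realize_meet, realize_join, realize_x, realize_y, realize_z] at this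
    exact this)
  { D with
    compl := complOp
    -- The type has no constants; by `zero_le` and `le_one` any element of the nonempty carrier
    -- defines the same bounds.
    bot := Classical.arbitrary A ⊓ complOp (Classical.arbitrary A)
    top := Classical.arbitrary A ⊔ complOp (Classical.arbitrary A)
    inf_compl_le_bot := fun a => zero_le a _
    top_le_sup_compl := fun a => le_one a _
    le_top := fun a => le_one _ a
    bot_le := fun a => zero_le _ a }

theorem le_iff (hA : A ∈ SA I) (a b : A) : le a b ↔ (boolAlg hA).le a b :=
  letI := boolAlg hA
  show a ⊓ b = a ↔ a ≤ b from inf_eq_left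

theorem transpOp_meetOp (hA : A ∈ SA I) {i j : I} (h : i ≠ j) (a b : A) :
    transpOp A i j (meetOp a b) = meetOp (transpOp A i j a) (transpOp A i j b) := by
  have := (Ax.transp_meet i j h).realize_eq hA (val a b b)
  simp only [realize_transp, realize_meet, realize_x, realize_y] at this
  exact this

theorem replOp_meetOp (hA : A ∈ SA I) {i j : I} (h : i ≠ j) (a b : A) :
    replOp A i j (meetOp a b) = meetOp (replOp A i j a) (replOp A i j b) := by
  have := (Ax.repl_meet i j h).realize_eq hA (val a b b)
  simp only [realize_repl, realize_meet, realize_x, realize_y] at this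
  exact this

/-- Preservation of `0`, `1`, meets and joins makes the image of `-a` a complement of the image of
`a`, and complements are unique. -/
theorem transpOp_complOp (hA : A ∈ SA I) {i j : I} (h : i ≠ j) (a : A) :
    transpOp A i j (complOp a) = complOp (transpOp A i j a) := by
  have h0 := (Ax.transp_zero i j h).realize_eq hA (val a a a)
  have h1 := (Ax.transp_one i j h).realize_eq hA (val a a a)
  have h2 := (Ax.transp_join i j h).realize_eq hA (val a (complOp a) a)
  simp only [Tm.zero, Tm.one, realize_transp, realize_meet, realize_neg, realize_join, realize_x,
    realize_y, val] at h0 h1 h2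
  rw [transpOp_meetOp hA h] at h0
  rw [h1] at h2
  let := boolAlg hA
  have h0 : transpOp A i j a ⊓ transpOp A i j aᶜ = a ⊓ aᶜ := h0
  have h2 : a ⊔ aᶜ = transpOp A i j a ⊔ transpOp A i j aᶜ := h2
  rw [inf_compl_self] at h0
  rw [sup_compl_eq_top] at h2
  exact (IsCompl.of_eq h0 h2.symm).compl_eq.symm

theorem replOp_complOp (hA : A ∈ SA I) {i j : I} (h : i ≠ j) (a : A) :
    replOp A i j (complOp a) = complOp (replOp A i j a) := by
  have h0 := (Ax.repl_zero i j h).realize_eq hA (val a a a)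
  have h1 := (Ax.repl_one i j h).realize_eq hA (val a a a)
  have h2 := (Ax.repl_join i j h).realize_eq hA (val a (complOp a) a)
  simp only [Tm.zero, Tm.one, realize_repl, realize_meet, realize_neg, realize_join, realize_x,
    realize_y, val] at h0 h1 h2
  rw [replOp_meetOp hA h] at h0
  rw [h1] at h2
  let := boolAlg hA
  have h0 : replOp A i j a ⊓ replOp A i j aᶜ = a ⊓ aᶜ := h0
  have h2 : a ⊔ aᶜ = replOp A i j a ⊔ replOp A i j aᶜ := h2
  rw [inf_compl_self] at h0
  rw [sup_compl_eq_top] at h2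
  exact (IsCompl.of_eq h0 h2.symm).compl_eq.symm

/-- A self-map that preserves the Boolean operations. -/
structure IsBoolEnd (s : A → A) : Prop where
  map_meet (a b : A) : s (meetOp a b) = meetOp (s a) (s b)
  map_compl (a : A) : s (complOp a) = complOp (s a)

theorem IsBoolEnd.id : IsBoolEnd (id : A → A) := ⟨fun _ _ => rfl, fun _ => rfl⟩

theorem IsBoolEnd.comp {s s' : A → A} (hs : IsBoolEnd s) (hs' : IsBoolEnd s') :
    IsBoolEnd (s ∘ s') :=
  ⟨fun a b => by simp only [Function.comp_apply, hs'.map_meet, hs.map_meet],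
    fun a => by simp only [Function.comp_apply, hs'.map_compl, hs.map_compl]⟩

theorem isBoolEnd_replOp (hA : A ∈ SA I) (i j : I) : IsBoolEnd (replOp A i j) := by
  by_cases h : i = j
  · rw [h, replOp_self]; exact IsBoolEnd.id
  · exact ⟨replOp_meetOp hA h, replOp_complOp hA h⟩

theorem isBoolEnd_transpOp (hA : A ∈ SA I) (i j : I) : IsBoolEnd (transpOp A i j) := by
  by_cases h : i = j
  · rw [h, transpOp_self]; exact IsBoolEnd.id
  · exact ⟨transpOp_meetOp hA h, transpOp_complOp hA h⟩

theorem isSubstRep_ops (hA : A ∈ SA I) : IsSubstRep (replOp A) (transpOp A) where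
  repl_self := replOp_self
  transp_self := transpOp_self
  transp_symm i j hij := funext fun a => by
    have := (Ax.transp_symm i j hij).realize_eq hA (val a a a)
    simp only [realize_transp] at this
    exact this
  transp_transp i j hij := funext fun a => by
    have := (Ax.transp_transp i j hij).realize_eq hA (val a a a)
    simp only [realize_transp] at this
    exact this
  transp_conj i j k hij hik hjk := funext fun a => by
    have := (Ax.transp_conj i j k hij hik hjk).realize_eq hA (val a a a)
    simp only [realize_transp] at this
    exact this
  transp_comm i j k l hij hik hil hjk hjl hkl := funext fun a => by
    have := (Ax.transp_comm i j k l hij hik hil hjk hjl hkl).realize_eq hA (val a a a)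
    simp only [realize_transp] at this
    exact this
  conj_disjoint i j k l hij hik hil hjk hjl hkl := funext fun a => by
    have := (Ax.conj_disjoint i j k l hij hik hil hjk hjl hkl).realize_eq hA (val a a a)
    simp only [realize_repl, realize_transp] at this
    exact this
  conj_upper i j k hij hik hjk := funext fun a => by
    have := (Ax.conj_upper i j k hij hik hjk).realize_eq hA (val a a a)
    simp only [realize_repl, realize_transp] at this
    exact this
  conj_lower i j k hij hik hjk := funext fun a => by
    have := (Ax.conj_lower i j k hij hik hjk).realize_eq hA (val a a a)
    simp only [realize_repl, realize_transp] at this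
    exact this
  conj_both i j hij := funext fun a => by
    have := (Ax.conj_both i j hij).realize_eq hA (val a a a)
    simp only [realize_repl, realize_transp] at this
    exact this
  repl_comm_disjoint i j k l hij hik hil hjk hjl hkl := funext fun a => by
    have := (Ax.repl_comm_disjoint i j k l hij hik hil hjk hjl hkl).realize_eq hA (val a a a)
    simp only [realize_repl] at this
    exact this
  repl_comm_lower i j k hij hik hjk := funext fun a => by
    have := (Ax.repl_comm_lower i j k hij hik hjk).realize_eq hA (val a a a)
    simp only [realize_repl] at this
    exact this
  repl_chain i j k hij hik hjk := funext fun a => by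
    have := (Ax.repl_chain i j k hij hik hjk).realize_eq hA (val a a a)
    simp only [realize_repl] at this
    exact this
  repl_repl_transp i j k hij hik hjk := funext fun a => by
    have := (Ax.repl_repl_transp i j k hij hik hjk).realize_eq hA (val a a a)
    simp only [realize_repl, realize_transp] at this
    exact this
  repl_upper i j k hij hik hjk := funext fun a => by
    have := (Ax.repl_upper i j k hij hik hjk).realize_eq hA (val a a a)
    simp only [realize_repl] at this
    exact this
  repl_idem i j hij := funext fun a => by
    have := (Ax.repl_idem i j hij).realize_eq hA (val a a a)
    simp only [realize_repl] at this
    exact this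
  repl_swap i j hij := funext fun a => by
    have := (Ax.repl_swap i j hij).realize_eq hA (val a a a)
    simp only [realize_repl] at this
    exact this
  repl_transp i j hij := funext fun a => by
    have := (Ax.repl_transp i j hij).realize_eq hA (val a a a)
    simp only [realize_repl, realize_transp] at this
    exact this

end Boolean

/-! ### Transport of the relations to other monoids -/

namespace IsSubstRep

variable {I M N : Type*} [Monoid M] [Monoid N] {r t : I → I → M} {r' t' : I → I → N}

theorem prod (h : IsSubstRep r t) (h' : IsSubstRep r' t') :
    IsSubstRep (fun i j => (r i j, r' i j)) (fun i j => (t i j, t' i j)) where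
  repl_self i := Prod.ext (h.repl_self i) (h'.repl_self i)
  transp_self i := Prod.ext (h.transp_self i) (h'.transp_self i)
  transp_symm i j hij := Prod.ext (h.transp_symm i j hij) (h'.transp_symm i j hij)
  transp_transp i j hij := Prod.ext (h.transp_transp i j hij) (h'.transp_transp i j hij)
  transp_conj i j k hij hik hjk :=
    Prod.ext (h.transp_conj i j k hij hik hjk)
      (h'.transp_conj i j k hij hik hjk)
  transp_comm i j k l hij hik hil hjk hjl hkl :=
    Prod.ext (h.transp_comm i j k l hij hik hil hjk hjl hkl)
      (h'.transp_comm i j k l hij hik hil hjk hjl hkl)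
  conj_disjoint i j k l hij hik hil hjk hjl hkl :=
    Prod.ext (h.conj_disjoint i j k l hij hik hil hjk hjl hkl)
      (h'.conj_disjoint i j k l hij hik hil hjk hjl hkl)
  conj_upper i j k hij hik hjk :=
    Prod.ext (h.conj_upper i j k hij hik hjk)
      (h'.conj_upper i j k hij hik hjk)
  conj_lower i j k hij hik hjk :=
    Prod.ext (h.conj_lower i j k hij hik hjk)
      (h'.conj_lower i j k hij hik hjk)
  conj_both i j hij := Prod.ext (h.conj_both i j hij) (h'.conj_both i j hij)
  repl_comm_disjoint i j k l hij hik hil hjk hjl hkl :=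
    Prod.ext (h.repl_comm_disjoint i j k l hij hik hil hjk hjl hkl)
      (h'.repl_comm_disjoint i j k l hij hik hil hjk hjl hkl)
  repl_comm_lower i j k hij hik hjk :=
    Prod.ext (h.repl_comm_lower i j k hij hik hjk)
      (h'.repl_comm_lower i j k hij hik hjk)
  repl_chain i j k hij hik hjk :=
    Prod.ext (h.repl_chain i j k hij hik hjk)
      (h'.repl_chain i j k hij hik hjk)
  repl_repl_transp i j k hij hik hjk :=
    Prod.ext (h.repl_repl_transp i j k hij hik hjk)
      (h'.repl_repl_transp i j k hij hik hjk)
  repl_upper i j k hij hik hjk :=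
    Prod.ext (h.repl_upper i j k hij hik hjk)
      (h'.repl_upper i j k hij hik hjk)
  repl_idem i j hij := Prod.ext (h.repl_idem i j hij) (h'.repl_idem i j hij)
  repl_swap i j hij := Prod.ext (h.repl_swap i j hij) (h'.repl_swap i j hij)
  repl_transp i j hij := Prod.ext (h.repl_transp i j hij) (h'.repl_transp i j hij)

/-- The relations carry over along a functional relation that is compatible with products. -/
theorem transfer (h : IsSubstRep r t) (R : M → N → Prop) (one : R 1 1)
    (mul : ∀ {m m' n n'}, R m n → R m' n' → R (m * m') (n * n'))
    (func : ∀ {m n n'}, R m n → R m n' → n = n') (hr : ∀ i j, R (r i j) (r' i j))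
    (ht : ∀ i j, R (t i j) (t' i j)) : IsSubstRep r' t' :=
  have key {m m' n n'} (e : m = m') (hm : R m n) (hm' : R m' n') : n = n' := func hm (e ▸ hm')
  { repl_self i := key (h.repl_self i) (hr i i) one
    transp_self i := key (h.transp_self i) (ht i i) one
    transp_symm i j hij :=
      key (h.transp_symm i j hij) (ht i j) (ht j i)
    transp_transp i j hij :=
      key (h.transp_transp i j hij) (mul (ht i j) (ht i j)) one
    transp_conj i j k hij hik hjk :=
      key (h.transp_conj i j k hij hik hjk) (mul (ht i j) (mul (ht j k) (ht i j))) (ht i k)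
    transp_comm i j k l hij hik hil hjk hjl hkl :=
      key (h.transp_comm i j k l hij hik hil hjk hjl hkl)
        (mul (ht i j) (ht k l)) (mul (ht k l) (ht i j))
    conj_disjoint i j k l hij hik hil hjk hjl hkl :=
      key (h.conj_disjoint i j k l hij hik hil hjk hjl hkl)
        (mul (ht k l) (mul (hr j i) (ht k l))) (hr j i)
    conj_upper i j k hij hik hjk :=
      key (h.conj_upper i j k hij hik hjk) (mul (ht j k) (mul (hr j i) (ht j k))) (hr k i)
    conj_lower i j k hij hik hjk :=
      key (h.conj_lower i j k hij hik hjk) (mul (ht k i) (mul (hr j i) (ht k i))) (hr j k)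
    conj_both i j hij :=
      key (h.conj_both i j hij) (mul (ht i j) (mul (hr j i) (ht i j))) (hr i j)
    repl_comm_disjoint i j k l hij hik hil hjk hjl hkl :=
      key (h.repl_comm_disjoint i j k l hij hik hil hjk hjl hkl)
        (mul (hr j i) (hr k l)) (mul (hr k l) (hr j i))
    repl_comm_lower i j k hij hik hjk :=
      key (h.repl_comm_lower i j k hij hik hjk) (mul (hr j i) (hr k i)) (mul (hr k i) (hr j i))
    repl_chain i j k hij hik hjk :=
      key (h.repl_chain i j k hij hik hjk) (mul (hr k i) (hr j i)) (mul (hr j i) (hr k j))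
    repl_repl_transp i j k hij hik hjk :=
      key (h.repl_repl_transp i j k hij hik hjk) (mul (hr j i) (hr i k)) (mul (hr j k) (ht i j))
    repl_upper i j k hij hik hjk :=
      key (h.repl_upper i j k hij hik hjk) (mul (hr j i) (hr j k)) (hr j k)
    repl_idem i j hij :=
      key (h.repl_idem i j hij) (mul (hr j i) (hr j i)) (hr j i)
    repl_swap i j hij :=
      key (h.repl_swap i j hij) (mul (hr j i) (hr i j)) (hr j i)
    repl_transp i j hij :=
      key (h.repl_transp i j hij) (mul (hr j i) (ht i j)) (hr j i) }

end IsSubstRep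

/-! ### Algebras of sets with operations given by point maps -/

section Flow

open MulOpposite

variable {I : Type u} {X : Type u} (ρ θ : I → I → X → X)

/-- The operations of the algebra of all subsets of `X`. -/
def flowOp : {n : ℕ} → Op I n → (Fin n → Set X) → Set X
  | _, .meet, Y => Y 0 ∩ Y 1
  | _, .compl, Y => (Y 0)ᶜ
  | _, .repl i j _, Y => ρ i j ⁻¹' Y 0
  | _, .transp i j _, Y => θ i j ⁻¹' Y 0

/-- The algebra of all subsets of `X`, where `sⁱⱼ` and `s_ij` take preimages under the maps `ρ i j`
and `θ i j`. -/
def flowAlg : Alg.{u} I where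
  carrier := Set X
  str :=
    { funMap := fun f Y => flowOp ρ θ f Y
      RelMap := fun r _ => r.elim }

variable {ρ θ}

/-- Taking preimages reverses composition, so the point maps must satisfy the relations in the
opposite monoid. -/
theorem flowAlg_mem_SA (h : IsSubstRep (M := (Function.End X)ᵐᵒᵖ)
    (fun i j => op (ρ i j)) (fun i j => op (θ i j))) : flowAlg ρ θ ∈ SA I := by
  rintro ⟨s, t⟩ hst v
  have key {m n : (Function.End X)ᵐᵒᵖ} (e : m = n) :
      m.unop ⁻¹' (v 0 : Set X) = n.unop ⁻¹' (v 0 : Set X) := by rw [e]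
  have preimage_zero (f : X → X) (Y : Set X) : f ⁻¹' (Y ∩ Yᶜ) = Y ∩ Yᶜ := by simp
  have preimage_one (f : X → X) (Y : Set X) :
      f ⁻¹' (Yᶜ ∩ Yᶜᶜ)ᶜ = (Yᶜ ∩ Yᶜᶜ)ᶜ := by simp
  have join_eq (Y Z : Set X) : (Yᶜ ∩ Zᶜ)ᶜ = Y ∪ Z := by
    rw [Set.compl_inter, compl_compl, compl_compl]
  change s.realize v = t.realize v
  cases hst with
  | meet_comm => exact Set.inter_comm (α := X) (v 0) (v 1)
  | meet_assoc => exact (Set.inter_assoc (α := X) (v 0) (v 1) (v 2)).symm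
  | join_comm =>
    exact (join_eq (v 0) (v 1)).trans ((Set.union_comm _ _).trans (join_eq (v 1) (v 0)).symm)
  | join_assoc =>
    have (x y z : Set X) : (xᶜ ∩ (yᶜ ∩ zᶜ)ᶜᶜ)ᶜ = ((xᶜ ∩ yᶜ)ᶜᶜ ∩ zᶜ)ᶜ := by
      simp only [join_eq, Set.union_assoc]
    exact this (v 0) (v 1) (v 2)
  | meet_join_absorb =>
    have (x y : Set X) : x ∩ (xᶜ ∩ yᶜ)ᶜ = x := by simp [join_eq]
    exact this (v 0) (v 1)
  | join_meet_absorb =>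
    have (x y : Set X) : (xᶜ ∩ (x ∩ y)ᶜ)ᶜ = x := by simp [join_eq]
    exact this (v 0) (v 1)
  | meet_join_distrib =>
    have (x y z : Set X) : x ∩ (yᶜ ∩ zᶜ)ᶜ = ((x ∩ y)ᶜ ∩ (x ∩ z)ᶜ)ᶜ := by
      simp only [join_eq, Set.inter_union_distrib_left]
    exact this (v 0) (v 1) (v 2)
  | join_meet_distrib =>
    have (x y z : Set X) : (xᶜ ∩ (y ∩ z)ᶜ)ᶜ = (xᶜ ∩ yᶜ)ᶜ ∩ (xᶜ ∩ zᶜ)ᶜ := by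
      simp only [join_eq, Set.union_inter_distrib_left]
    exact this (v 0) (v 1) (v 2)
  | join_zero =>
    have (x y : Set X) : (yᶜ ∩ (x ∩ xᶜ)ᶜ)ᶜ = y := by simp
    exact this (v 0) (v 1)
  | meet_one =>
    have (x y : Set X) : y ∩ (xᶜ ∩ xᶜᶜ)ᶜ = y := by simp
    exact this (v 0) (v 1)
  | transp_meet | transp_join | repl_meet | repl_join => rfl
  | transp_zero | repl_zero => exact preimage_zero _ (v 0)
  | transp_one | repl_one => exact preimage_one _ (v 0)
  | transp_symm i j hij => exact key (h.transp_symm i j hij)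
  | transp_transp i j hij => exact key (h.transp_transp i j hij)
  | transp_conj i j k hij hik hjk => exact key (h.transp_conj i j k hij hik hjk)
  | transp_comm i j k l hij hik hil hjk hjl hkl =>
    exact key (h.transp_comm i j k l hij hik hil hjk hjl hkl)
  | conj_disjoint i j k l hij hik hil hjk hjl hkl =>
    exact key (h.conj_disjoint i j k l hij hik hil hjk hjl hkl)
  | conj_upper i j k hij hik hjk => exact key (h.conj_upper i j k hij hik hjk)
  | conj_lower i j k hij hik hjk => exact key (h.conj_lower i j k hij hik hjk)
  | conj_both i j hij => exact key (h.conj_both i j hij)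
  | repl_comm_disjoint i j k l hij hik hil hjk hjl hkl =>
    exact key (h.repl_comm_disjoint i j k l hij hik hil hjk hjl hkl)
  | repl_comm_lower i j k hij hik hjk => exact key (h.repl_comm_lower i j k hij hik hjk)
  | repl_chain i j k hij hik hjk => exact key (h.repl_chain i j k hij hik hjk)
  | repl_repl_transp i j k hij hik hjk => exact key (h.repl_repl_transp i j k hij hik hjk)
  | repl_upper i j k hij hik hjk => exact key (h.repl_upper i j k hij hik hjk)
  | repl_idem i j hij => exact key (h.repl_idem i j hij)
  | repl_swap i j hij => exact key (h.repl_swap i j hij)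
  | repl_transp i j hij => exact key (h.repl_transp i j hij)

end Flow

/-! ### Ultrafilters -/

section Ultrafilters

/-- The ultrafilter is the complement of a prime ideal disjoint from the filter generated by `Φ`. -/
theorem exists_ultrafilter {B : Type*} [BooleanAlgebra B] (Φ : Set B) (hne : Φ.Nonempty)
    (hinf : ∀ a ∈ Φ, ∀ b ∈ Φ, a ⊓ b ∈ Φ) (hbot : ⊥ ∉ Φ) :
    ∃ F : Set B, Φ ⊆ F ∧ (∀ a b, a ⊓ b ∈ F ↔ a ∈ F ∧ b ∈ F) ∧ ∀ a, aᶜ ∈ F ↔ a ∉ F := by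
  have hG : Order.IsPFilter {b : B | ∃ a ∈ Φ, a ≤ b} := by
    refine Order.IsPFilter.of_def ?_ ?_ ?_
    · obtain ⟨a, ha⟩ := hne
      exact ⟨a, a, ha, le_rfl⟩
    · rintro b ⟨a, ha, hab⟩ b' ⟨a', ha', hab'⟩
      exact ⟨a ⊓ a', ⟨_, hinf a ha a' ha', le_rfl⟩, inf_le_left.trans hab,
        inf_le_right.trans hab'⟩
    · rintro b b' hbb' ⟨a, ha, hab⟩
      exact ⟨a, ha, hab.trans hbb'⟩
  obtain ⟨J, hJ, -, hdisj⟩ := DistribLattice.prime_ideal_of_disjoint_filter_ideal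
    (F := hG.toPFilter) (I := (⊥ : Order.Ideal B)) (by
      rw [Set.disjoint_left]
      rintro b ⟨a, ha, hab⟩ hb
      exact hbot (le_bot_iff.1 (hab.trans (Order.Ideal.mem_principal.1 hb)) ▸ ha))
  rw [Set.disjoint_left] at hdisj
  refine ⟨(J : Set B)ᶜ, fun a ha => hdisj ⟨a, ha, le_rfl⟩, fun a b => ?_, fun a => ?_⟩
  · rw [← not_iff_not, not_and_or]
    simp only [Set.mem_compl_iff, SetLike.mem_coe, not_not]
    exact ⟨hJ.mem_or_mem, fun h => h.elim (J.lower inf_le_left) (J.lower inf_le_right)⟩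
  · simp only [Set.mem_compl_iff, SetLike.mem_coe, not_not]
    refine ⟨fun h => hJ.mem_or_compl_mem.resolve_right h, fun h h' => ?_⟩
    have := J.sup_mem h h'
    rw [sup_compl_eq_top] at this
    exact hJ.toIsProper.ne_top (Order.Ideal.top_of_top_mem this)

variable {I : Type u}

/-- The ultrafilters of an algebra. -/
@[ext]
structure Ult (A : Alg.{u} I) where
  carrier : Set A
  meet_mem (a b : A) : meetOp a b ∈ carrier ↔ a ∈ carrier ∧ b ∈ carrier
  compl_mem (a : A) : complOp a ∈ carrier ↔ a ∉ carrier

/-- The preimage of an ultrafilter. -/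
def Ult.comap {A : Alg.{u} I} (F : Ult A) {s : A → A} (hs : IsBoolEnd s) : Ult A where
  carrier := s ⁻¹' F.carrier
  meet_mem a b := by simp only [Set.mem_preimage, hs.map_meet, F.meet_mem]
  compl_mem a := by simp only [Set.mem_preimage, hs.map_compl, F.compl_mem]

variable {A B C : Alg.{u} I}

theorem exists_ult (hA : A ∈ SA I) (Φ : Set A) (hne : Φ.Nonempty)
    (hinf : ∀ a ∈ Φ, ∀ b ∈ Φ, meetOp a b ∈ Φ) (hbot : (boolAlg hA).bot ∉ Φ) :
    ∃ F : Ult A, Φ ⊆ F.carrier := by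
  let := boolAlg hA
  obtain ⟨F, hΦ, h1, h2⟩ := exists_ultrafilter Φ hne hinf hbot
  exact ⟨⟨F, h1, h2⟩, hΦ⟩

theorem exists_ult_of_not_le (hA : A ∈ SA I) {a b : A} (h : ¬ (boolAlg hA).le a b) :
    ∃ F : Ult A, a ∈ F.carrier ∧ b ∉ F.carrier := by
  let := boolAlg hA
  obtain ⟨F, hF⟩ := exists_ult hA {a ⊓ bᶜ} ⟨_, rfl⟩
    (by rintro x rfl y rfl; exact inf_idem (a ⊓ bᶜ))
    (fun h' => h (le_compl_iff_disjoint_right.2 (disjoint_iff.2 h'.symm) |>.trans (by simp)))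
  have := (F.meet_mem a bᶜ).1 (hF rfl)
  exact ⟨F, this.1, (F.compl_mem b).1 this.2⟩

theorem eq_of_ult (hA : A ∈ SA I) {a b : A}
    (h : ∀ F : Ult A, a ∈ F.carrier ↔ b ∈ F.carrier) : a = b := by
  let := boolAlg hA
  by_contra hab
  by_cases hle : a ≤ b
  · obtain ⟨F, h1, h2⟩ := exists_ult_of_not_le hA fun h => hab (le_antisymm hle h)
    exact h2 ((h F).2 h1)
  · obtain ⟨F, h1, h2⟩ := exists_ult_of_not_le hA hle
    exact h2 ((h F).1 h1)

theorem map_bot (hA : A ∈ SA I) (hB : B ∈ SA I) (f : A →[lang I] B) :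
    f (boolAlg hA).bot = (boolAlg hB).bot := by
  let := boolAlg hA
  let := boolAlg hB
  have h1 : (⊥ : A) = meetOp (⊥ : A) (complOp ⊥) := (bot_inf_eq _).symm
  change f (⊥ : A) = ⊥
  rw [h1, map_meetOp, map_complOp]
  exact inf_compl_self (f ⊥)

/-- An ultrafilter of a subalgebra extends to an ultrafilter of the algebra that contains `b`, if
`b` is compatible with all its members. -/
theorem Ult.exists_extension (hA : A ∈ SA I) (hB : B ∈ SA I) (f : A →[lang I] B) (P : Ult A)
    (b : B) (hb : ∀ a ∈ P.carrier, meetOp (f a) b ≠ (boolAlg hB).bot) :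
    ∃ F : Ult B, b ∈ F.carrier ∧ ∀ a, f a ∈ F.carrier ↔ a ∈ P.carrier := by
  let := boolAlg hA
  let := boolAlg hB
  obtain ⟨F, hF⟩ := exists_ult hB {x | ∃ a ∈ P.carrier, x = meetOp (f a) b}
    (by
      obtain ⟨a, ha⟩ : ∃ a, a ∈ P.carrier := by
        by_cases h : Classical.arbitrary A ∈ P.carrier
        · exact ⟨_, h⟩
        · exact ⟨_, (P.compl_mem _).2 h⟩
      exact ⟨_, a, ha, rfl⟩)
    (by
      rintro x ⟨a, ha, rfl⟩ y ⟨a', ha', rfl⟩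
      refine ⟨meetOp a a', (P.meet_mem a a').2 ⟨ha, ha'⟩, ?_⟩
      rw [map_meetOp]
      exact (inf_inf_distrib_right (f a) (f a') b).symm)
    (by
      rintro ⟨a, ha, h⟩
      exact hb a ha h.symm)
  have key (a : A) (ha : a ∈ P.carrier) : f a ∈ F.carrier ∧ b ∈ F.carrier :=
    (F.meet_mem _ _).1 (hF ⟨a, ha, rfl⟩)
  have iff (a : A) : f a ∈ F.carrier ↔ a ∈ P.carrier := by
    refine ⟨fun h => ?_, fun h => (key a h).1⟩
    by_contra h'
    have := (key _ ((P.compl_mem a).2 h')).1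
    rw [map_complOp, F.compl_mem] at this
    exact this h
  refine ⟨F, ?_, iff⟩
  by_cases h : Classical.arbitrary A ∈ P.carrier
  · exact (key _ h).2
  · exact (key _ ((P.compl_mem _).2 h)).2

end Ultrafilters

/-! ### Representation by set algebras -/

section Representation

variable {I : Type u}

theorem setAlg_mem_SA {V : Set (I → I)} (hV : LocallySquare V) : setAlg V ∈ SA I := by
  let ρ (i j : I) (q : V) : V := ⟨q ∘ replMap i j, (hV q q.2 i j).1⟩
  let θ (i j : I) (q : V) : V := ⟨q ∘ transpMap i j, (hV q q.2 i j).2⟩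
  have hflow : flowAlg ρ θ ∈ SA I := flowAlg_mem_SA <|
    (isSubstRep_maps I).transfer
      (fun σ n => ∀ q : V, ((n.unop q : V) : I → I) = (q : I → I) ∘ σ)
      (fun _ => rfl)
      (fun {_ m' _ _} h h' q => (h' _).trans (congrArg (· ∘ m') (h q)))
      (fun h h' => MulOpposite.unop_injective (funext fun q =>
        Subtype.ext ((h q).trans (h' q).symm)))
      (fun _ _ _ => rfl) (fun _ _ _ => rfl)
  -- Local squareness makes precomposition a self-map of `V`, so `setSubst` is a preimage and `℘(V)`
  -- has the operations of a `flowAlg`.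
  have subst_eq (σ : I → I) (φ : V → V) (hφ : ∀ q, (φ q : I → I) = q ∘ σ) (Y : Set V) :
      setSubst σ Y = φ ⁻¹' Y := by
    ext q
    refine ⟨?_, fun h => ⟨φ q, h, hφ q⟩⟩
    rintro ⟨p, hp, hpq⟩
    have : p = φ q := Subtype.ext (hpq.trans (hφ q).symm)
    rwa [this] at hp
  refine (isVariety_Mod _).sub _ hflow _ (homOfOps (fun Y => Y) (fun _ _ => rfl) (fun _ => rfl)
    (fun i j h Y => ?_) (fun i j h Y => ?_)) fun _ _ h => h
  · exact (replOp_of_ne h Y).trans ((subst_eq _ (ρ i j) (fun _ => rfl) Y).trans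
      (replOp_of_ne (A := flowAlg ρ θ) h Y).symm)
  · exact (transpOp_of_ne h Y).trans ((subst_eq _ (θ i j) (fun _ => rfl) Y).trans
      (transpOp_of_ne (A := flowAlg ρ θ) h Y).symm)

theorem WSA_subset_SA : WSA I ⊆ SA I :=
  Set.sInter_subset_of_mem ⟨isVariety_Mod _, by
    rintro _ ⟨V, -, hV, rfl⟩
    exact setAlg_mem_SA hV⟩

theorem SubstWord.isBoolEnd {A : Alg.{u} I} (hA : A ∈ SA I) {τ : I → I} {m : Function.End A}
    (w : SubstWord (replOp A) (transpOp A) τ m) : IsBoolEnd m := by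
  induction w with
  | one => exact IsBoolEnd.id
  | mul_repl i j _ ih => exact ih.comp (isBoolEnd_replOp hA i j)
  | mul_transp i j _ ih => exact ih.comp (isBoolEnd_transpOp hA i j)

theorem SA_subset_WSA [Infinite I] : SA I ⊆ WSA I := by
  rintro A hA W ⟨hW, hK⟩
  have hrep := isSubstRep_ops hA
  let V : Set (I → I) := {τ | ∃ m, SubstWord (replOp A) (transpOp A) τ m}
  have hVW : setAlg V ∈ W := hK ⟨V, fun τ ⟨m, w⟩ => w.mem_weakSet,
    fun τ ⟨m, w⟩ i j => ⟨⟨_, w.mul_repl i j⟩, ⟨_, w.mul_transp i j⟩⟩, rfl⟩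
  let φ (F : Ult A) (a : A) : Set V :=
    {τ | ∃ m, SubstWord (replOp A) (transpOp A) (τ : I → I) m ∧ m a ∈ F.carrier}
  -- The presentation theorem enters here: membership may be tested with any word for `τ`, in
  -- particular with one extended by a letter.
  have mem_φ {F : Ult A} {a : A} {τ : V} {m : Function.End A}
      (w : SubstWord (replOp A) (transpOp A) (τ : I → I) m) : τ ∈ φ F a ↔ m a ∈ F.carrier := by
    refine ⟨?_, fun h => ⟨m, w, h⟩⟩
    rintro ⟨m', w', h⟩
    rwa [w.unique hrep w']
  refine hW.sub _ (hW.prod (Ult A) (fun _ => setAlg V) fun _ => hVW) A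
    (homOfOps (fun a F => φ F a) ?_ ?_ ?_ ?_) ?_
  · refine fun a b => funext fun F => Set.ext fun τ => ?_
    obtain ⟨m, w⟩ := τ.2
    refine (mem_φ w).trans ?_
    rw [(w.isBoolEnd hA).map_meet, F.meet_mem]
    exact (and_congr (mem_φ w) (mem_φ w)).symm
  · refine fun a => funext fun F => Set.ext fun τ => ?_
    obtain ⟨m, w⟩ := τ.2
    refine (mem_φ w).trans ?_
    rw [(w.isBoolEnd hA).map_compl, F.compl_mem]
    exact (not_congr (mem_φ w)).symm
  · refine fun i j h a => ?_
    refine Eq.trans ?_ (replOp_of_ne (A := prod fun _ : Ult A => setAlg V) h _).symm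
    refine funext fun F => Set.ext fun τ => ?_
    obtain ⟨m, w⟩ := τ.2
    have w' := w.mul_repl i j
    refine (mem_φ w).trans ?_
    change _ ↔ ∃ p ∈ φ F a, (p : I → I) = (τ : I → I) ∘ replMap i j
    refine ⟨fun h => ⟨⟨_, _, w'⟩, (mem_φ w').2 h, rfl⟩, ?_⟩
    rintro ⟨p, hp, hpτ⟩
    rw [← hpτ] at w'
    exact (mem_φ w').1 hp
  · refine fun i j h a => ?_
    refine Eq.trans ?_ (transpOp_of_ne (A := prod fun _ : Ult A => setAlg V) h _).symm
    refine funext fun F => Set.ext fun τ => ?_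
    obtain ⟨m, w⟩ := τ.2
    have w' := w.mul_transp i j
    refine (mem_φ w).trans ?_
    change _ ↔ ∃ p ∈ φ F a, (p : I → I) = (τ : I → I) ∘ transpMap i j
    refine ⟨fun h => ⟨⟨_, _, w'⟩, (mem_φ w').2 h, rfl⟩, ?_⟩
    rintro ⟨p, hp, hpτ⟩
    rw [← hpτ] at w'
    exact (mem_φ w').1 hp
  · intro a b hab
    refine eq_of_ult hA fun F => ?_
    -- At the identity map, `φ F a` records whether `a` belongs to `F`, and ultrafilters separate
    -- elements.
    have w : SubstWord (replOp A) (transpOp A) id 1 := .one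
    have hF : φ F a = φ F b := congrFun hab F
    have h1 := mem_φ (F := F) (a := a) (τ := ⟨id, _, w⟩) w
    have h2 := mem_φ (F := F) (a := b) (τ := ⟨id, _, w⟩) w
    rw [hF] at h1
    exact h1.symm.trans h2

end Representation

/-! ### Superamalgamation -/

section Superamalgamation

variable {I : Type u} {A B C : Alg.{u} I}

/-- The pairs of ultrafilters of `B` and `C` that agree on the common subalgebra. -/
def UltPair (f : A →[lang I] B) (g : A →[lang I] C) : Type u :=
  {x : Ult B × Ult C // ∀ a, f a ∈ x.1.carrier ↔ g a ∈ x.2.carrier}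

namespace UltPair

variable {f : A →[lang I] B} {g : A →[lang I] C}

/-- The preimage of a pair of ultrafilters under endomorphisms of `B` and of `C` that restrict to
the same endomorphism of `A`. -/
def comap {s : A → A} {s' : B → B} {s'' : C → C} (hf : ∀ a, f (s a) = s' (f a))
    (hg : ∀ a, g (s a) = s'' (g a)) (hs' : IsBoolEnd s') (hs'' : IsBoolEnd s'')
    (x : UltPair f g) : UltPair f g :=
  ⟨(x.1.1.comap hs', x.1.2.comap hs''), fun a => by
    have := x.2 (s a)
    rwa [hf, hg] at this⟩

end UltPair

/-- The amalgam of `B` and `C` over `A`. -/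
noncomputable def amalgam (hB : B ∈ SA I) (hC : C ∈ SA I) (f : A →[lang I] B)
    (g : A →[lang I] C) : Alg.{u} I :=
  flowAlg (X := UltPair f g)
    (fun i j => UltPair.comap (map_replOp f i j) (map_replOp g i j)
      (isBoolEnd_replOp hB i j) (isBoolEnd_replOp hC i j))
    (fun i j => UltPair.comap (map_transpOp f i j) (map_transpOp g i j)
      (isBoolEnd_transpOp hB i j) (isBoolEnd_transpOp hC i j))

/-- The relations hold for pairs of operations on `B` and `C`, and a pair of endomorphisms
determines the induced map on pairs of ultrafilters. -/
theorem amalgam_mem_SA (hB : B ∈ SA I) (hC : C ∈ SA I) (f : A →[lang I] B)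
    (g : A →[lang I] C) : amalgam hB hC f g ∈ SA I :=
  flowAlg_mem_SA <| ((isSubstRep_ops hB).prod (isSubstRep_ops hC)).transfer
    (fun s n => ∀ x : UltPair f g, (n.unop x).1.1.carrier = s.1 ⁻¹' x.1.1.carrier ∧
      (n.unop x).1.2.carrier = s.2 ⁻¹' x.1.2.carrier)
    (fun _ => ⟨rfl, rfl⟩)
    (fun {_ m' _ _} h h' x => ⟨(h' _).1.trans (congrArg (m'.1 ⁻¹' ·) (h x).1),
      (h' _).2.trans (congrArg (m'.2 ⁻¹' ·) (h x).2)⟩)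
    (fun h h' => MulOpposite.unop_injective (funext fun x => Subtype.ext (Prod.ext
      (Ult.ext ((h x).1.trans (h' x).1.symm)) (Ult.ext ((h x).2.trans (h' x).2.symm)))))
    (fun _ _ _ => ⟨rfl, rfl⟩) (fun _ _ _ => ⟨rfl, rfl⟩)

/-- The embedding of `B` into the amalgam. -/
noncomputable def amalgamLeft (hB : B ∈ SA I) (hC : C ∈ SA I) (f : A →[lang I] B)
    (g : A →[lang I] C) : B →[lang I] amalgam hB hC f g :=
  homOfOps (B := amalgam hB hC f g) (fun b => {x : UltPair f g | b ∈ x.1.1.carrier})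
    (fun a b => Set.ext fun x => x.1.1.meet_mem a b)
    (fun a => Set.ext fun x => x.1.1.compl_mem a)
    (fun _ _ h a => (replOp_of_ne (A := amalgam hB hC f g) h
      {x : UltPair f g | a ∈ x.1.1.carrier}).symm)
    (fun _ _ h a => (transpOp_of_ne (A := amalgam hB hC f g) h
      {x : UltPair f g | a ∈ x.1.1.carrier}).symm)

/-- The embedding of `C` into the amalgam. -/
noncomputable def amalgamRight (hB : B ∈ SA I) (hC : C ∈ SA I) (f : A →[lang I] B)
    (g : A →[lang I] C) : C →[lang I] amalgam hB hC f g :=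
  homOfOps (B := amalgam hB hC f g) (fun c => {x : UltPair f g | c ∈ x.1.2.carrier})
    (fun a b => Set.ext fun x => x.1.2.meet_mem a b)
    (fun a => Set.ext fun x => x.1.2.compl_mem a)
    (fun _ _ h a => (replOp_of_ne (A := amalgam hB hC f g) h
      {x : UltPair f g | a ∈ x.1.2.carrier}).symm)
    (fun _ _ h a => (transpOp_of_ne (A := amalgam hB hC f g) h
      {x : UltPair f g | a ∈ x.1.2.carrier}).symm)

/-- An ultrafilter of `A` has an extension to an algebra that includes `A`. -/
theorem Ult.exists_extension_of_injective (hA : A ∈ SA I) (hB : B ∈ SA I) {f : A →[lang I] B}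
    (hf : Function.Injective f) (P : Ult A) :
    ∃ F : Ult B, ∀ a, f a ∈ F.carrier ↔ a ∈ P.carrier := by
  let := boolAlg hA
  let := boolAlg hB
  obtain ⟨F, -, hF⟩ := Ult.exists_extension hA hB f P (⊤ : B) fun a ha h => by
    have h : f a ⊓ ⊤ = ⊥ := h
    rw [inf_top_eq] at h
    have : a = (⊥ : A) := hf (h.trans (map_bot hA hB f).symm)
    have h0 : (⊥ : A) = ⊥ ⊓ ⊥ᶜ := (bot_inf_eq _).symm
    rw [this, h0] at ha
    have := (P.meet_mem _ _).1 ha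
    exact (P.compl_mem _).1 this.2 this.1
  exact ⟨F, hF⟩

/-- The restriction of an ultrafilter to a subalgebra. -/
def Ult.restrict (f : A →[lang I] B) (F : Ult B) : Ult A where
  carrier := f ⁻¹' F.carrier
  meet_mem a b := by simp only [Set.mem_preimage, map_meetOp, F.meet_mem]
  compl_mem a := by simp only [Set.mem_preimage, map_complOp, F.compl_mem]

/-- If no member of `A` interpolates between `b` and `c`, then some ultrafilters of `B` and `C` that
agree on `A` contain `b` and omit `c`. -/
theorem exists_ult_of_no_interpolant (hA : A ∈ SA I) (hB : B ∈ SA I) (hC : C ∈ SA I)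
    (f : A →[lang I] B) (g : A →[lang I] C) (b : B) (c : C)
    (h : ¬ ∃ a : A, le b (f a) ∧ le (g a) c) :
    ∃ (F : Ult B) (G : Ult C), (∀ a, f a ∈ F.carrier ↔ g a ∈ G.carrier) ∧
      b ∈ F.carrier ∧ c ∉ G.carrier := by
  simp only [le_iff hB, le_iff hC] at h
  let := boolAlg hA
  let := boolAlg hB
  let := boolAlg hC
  have fmeet (x y : A) : f (x ⊓ y) = f x ⊓ f y := map_meetOp f x y
  have gmeet (x y : A) : g (x ⊓ y) = g x ⊓ g y := map_meetOp g x y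
  have fcompl (x : A) : f xᶜ = (f x)ᶜ := map_complOp f x
  have gcompl (x : A) : g xᶜ = (g x)ᶜ := map_complOp g x
  have fbot : f (⊥ : A) = ⊥ := map_bot hA hB f
  have gbot : g (⊥ : A) = ⊥ := map_bot hA hC g
  have ftop : f (⊤ : A) = ⊤ := by rw [← compl_bot, fcompl, fbot, compl_bot]
  have gtop : g (⊤ : A) = ⊤ := by rw [← compl_bot, gcompl, gbot, compl_bot]
  have h : ¬ ∃ a : A, b ≤ f a ∧ g a ≤ c := h
  -- `P` has to contain every `a` above `b` and every `a'` above `cᶜ`, so that it extends to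
  -- ultrafilters containing `b` and `cᶜ`. If such `a` and `a'` were disjoint, `a'ᶜ` would
  -- interpolate.
  obtain ⟨P, hP⟩ := exists_ult hA {x | ∃ a a' : A, b ≤ f a ∧ cᶜ ≤ g a' ∧ x = a ⊓ a'}
    ⟨⊤ ⊓ ⊤, ⊤, ⊤, by rw [ftop]; exact le_top, by rw [gtop]; exact le_top, rfl⟩
    (by
      rintro _ ⟨x, x', hx, hx', rfl⟩ _ ⟨y, y', hy, hy', rfl⟩
      exact ⟨x ⊓ y, x' ⊓ y', by rw [fmeet]; exact le_inf hx hy,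
        by rw [gmeet]; exact le_inf hx' hy', inf_inf_inf_comm x x' y y'⟩)
    (by
      rintro ⟨x, x', hx, hx', hxx'⟩
      have hle : x ≤ x'ᶜ := le_compl_iff_disjoint_right.2 (disjoint_iff.2 hxx'.symm)
      refine h ⟨x'ᶜ, hx.trans ?_, ?_⟩
      · rw [← inf_eq_left, ← fmeet, inf_eq_left.2 hle]
      · rw [gcompl]; exact compl_le_of_compl_le hx')
  have hP1 (a : A) (ha : b ≤ f a) : a ∈ P.carrier :=
    ((P.meet_mem a (⊤ : A)).1 (hP ⟨a, ⊤, ha, by rw [gtop]; exact le_top, rfl⟩)).1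
  have hP2 (a : A) (ha : cᶜ ≤ g a) : a ∈ P.carrier :=
    ((P.meet_mem (⊤ : A) a).1 (hP ⟨⊤, a, by rw [ftop]; exact le_top, ha, rfl⟩)).2
  obtain ⟨F, hbF, hF⟩ := P.exists_extension hA hB f b fun a ha h' => by
    have h' : f a ⊓ b = ⊥ := h'
    -- If `f a` were disjoint from `b`, then `aᶜ` would lie above `b` and hence belong to `P`.
    refine (P.compl_mem a).1 (hP1 aᶜ ?_) ha
    rw [fcompl]
    exact le_compl_iff_disjoint_left.2 (disjoint_iff.2 h')
  obtain ⟨G, hcG, hG⟩ := P.exists_extension hA hC g cᶜ fun a ha h' => by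
    have h' : g a ⊓ cᶜ = ⊥ := h'
    refine (P.compl_mem a).1 (hP2 aᶜ ?_) ha
    rw [gcompl]
    exact le_compl_iff_disjoint_left.2 (disjoint_iff.2 h')
  exact ⟨F, G, fun a => (hF a).trans (hG a).symm, hbF, (G.compl_mem c).1 hcG⟩

theorem hasSuperamalgamation_SA (I : Type u) : HasSuperamalgamation (SA I) := by
  intro A hA B hB C hC f g hf hg
  refine ⟨amalgam hB hC f g, amalgam_mem_SA hB hC f g, amalgamLeft hB hC f g,
    amalgamRight hB hC f g, ?_, ?_, ?_, ?_, ?_⟩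
  · intro b b' hbb'
    refine eq_of_ult hB fun F => ?_
    obtain ⟨G, hG⟩ := (F.restrict f).exists_extension_of_injective hA hC hg
    exact Set.ext_iff.1 hbb' (⟨(F, G), fun a => (hG a).symm⟩ : UltPair f g)
  · intro c c' hcc'
    refine eq_of_ult hC fun G => ?_
    obtain ⟨F, hF⟩ := (G.restrict g).exists_extension_of_injective hA hB hf
    exact Set.ext_iff.1 hcc' (⟨(F, G), fun a => hF a⟩ : UltPair f g)
  · exact fun a => Set.ext fun x => x.2 a
  · intro b c hbc
    by_contra h
    obtain ⟨F, G, hFG, hb, hc⟩ := exists_ult_of_no_interpolant hA hB hC f g b c h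
    have := (Set.ext_iff.1 hbc (⟨(F, G), hFG⟩ : UltPair f g)).2 hb
    exact hc this.2
  · intro b c hcb
    by_contra h
    obtain ⟨G, F, hGF, hc, hb⟩ := exists_ult_of_no_interpolant hA hC hB g f c b h
    have := (Set.ext_iff.1 hcb (⟨(F, G), fun a => (hGF a).symm⟩ : UltPair f g)).2 hc
    exact hb this.2

end Superamalgamation

end SubstAlg

theorem mainTheorem7 (α : Ordinal.{u}) (hα : Ordinal.omega0 ≤ α) :
    SubstAlg.SA α.ToType = SubstAlg.WSA α.ToType ∧
      SubstAlg.HasSuperamalgamation (SubstAlg.SA α.ToType) := by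
  have : Infinite α.ToType := by
    rw [Cardinal.infinite_iff, Cardinal.mk_toType, Ordinal.aleph0_le_card]
    exact hα
  exact ⟨SubstAlg.SA_subset_WSA.antisymm SubstAlg.WSA_subset_SA,
    SubstAlg.hasSuperamalgamation_SA _⟩
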